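/- Let $\mathbb T^2=\mathbb R^2/\mathbb Z^2$, $\frac12<\alpha<1$, $s+\alpha>2$ and $T>0$. Let $K:\mathbb T^2\to\mathbb R$ satisfy $K\in L^1(\mathbb T^2)\cap C^\infty(\mathbb T^2\setminus\{0\})$ and, for some constants $c,C>0$, $c|k|^{-1}\le \hat K(k)\le C|k|^{-1}$ for all $k\in\mathbb Z^2\setminus\{0\}$ (in particular $\hat K(k)$ is real). Put $\mathcal K\theta=K*\theta$ and $\mathcal R\theta=(-\partial_2\mathcal K\theta,\ \partial_1\mathcal K\theta)$, and suppose that $\mathcal R$ is bounded on $L^p(\mathbb T^2)$ for every $p\in(1,\infty)$. Let $H^r(\mathbb T^2)$ carry the norm $\|u\|_{H^r}^2=\sum_{k\in\mathbb Z^2}(1+|k|^2)^r|\hat u(k)|^2$, and let $(-\Delta)^\alpha$ be the Fourier multiplier with symbol $|2\pi k|^{2\alpha}$. For a real-valued source $f\in C_c^\infty(\mathbb T^2\times(0,T))$ let $\theta_f\in L^\infty(0,T;H^s(\mathbb T^2))\cap L^2(0,T;H^{s+\alpha}(\mathbb T^2))$ denote a real-valued weak solution of $$\partial_t\theta+\mathcal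 R\theta\cdot\nabla\theta+(-\Delta)^\alpha\theta=f\ \text{ in }\mathbb T^2\times(0,T),\qquad \theta(0)=0 .$$ Let $f_1,f_2\in C_c^\infty(\mathbb T^2\times(0,T))$ be real-valued and, for $j=1,2$, let $w_j\in L^2(0,T;H^\alpha(\mathbb T^2))\cap C([0,T];L^2(\mathbb T^2))$ denote the weak solution of the linear problem $$\partial_t w+(-\Delta)^\alpha w=f_j\ \text{ in }\mathbb T^2\times(0,T),\qquad w(0)=0 .$$ (Weak solutions are understood by testing against $\varphi\in C_c^\infty(\mathbb T^2\times(-\infty,T))$, restricted to times in $(0,T)$, with zero initial data.) Suppose that solutions $\theta_{\epsilon f_1}$, $\theta_{\epsilon f_2}$, $\theta_{\epsilon(f_1+f_2)}$ in this class are given for all sufficiently small real $\epsilon\ne0$. Then, for $j=1,2$, $$\frac{\theta_{\epsilon f_j}}{\epsilon}\to w_j,\qquad \frac{\theta_{\epsilon(f_1+f_2)}-\theta_{\epsilon f_j}}{\epsilon}\to w_{3-j}$$ in $L^2(0,T;H^{2\alpha}(\mathbb T^2))\cap L^\infty(0,T;H^{\alpha}(\mathbb T^2))$ as $\epsilon\to0$,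 $\epsilon\neq0$. -/

import Mathlib

open MeasureTheory Set Filter
open scoped Topology ENNReal NNReal ContDiff

noncomputable section

namespace ActiveScalar

/-- The two-dimensional torus `ℝ² / ℤ²`. -/
abbrev Torus : Type := UnitAddTorus (Fin 2)

/-- Lebesgue measure on the torus, of total mass one. -/
abbrev torusMeasure : Measure Torus := Measure.pi fun _ => AddCircle.haarAddCircle

/-- Real square integrable functions on the torus, modulo null sets. -/
abbrev L2Torus : Type := Lp ℝ 2 torusMeasure

/-- The quotient map `ℝ² → 𝕋²`. -/
def toTorus (x : Fin 2 → ℝ) : Torus := fun i => (x i : UnitAddCircle)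

/-- The Euclidean length `|k|` of a frequency. -/
def freqNorm (k : Fin 2 → ℤ) : ℝ := Real.sqrt (∑ i, (k i : ℝ) ^ 2)

/-- The Fourier coefficient `∫ g(x) e^{-2πi k·x} dx` of a real function. -/
def torusCoeff (g : Torus → ℝ) (k : Fin 2 → ℤ) : ℂ :=
  UnitAddTorus.mFourierCoeff (fun x => (g x : ℂ)) k

/-! Sobolev spaces and time-dependent functions -/

/-- The norm of `H^r(𝕋²)`, equal to `∞` off `H^r(𝕋²)`. -/
def sobolevNorm (r : ℝ) (g : L2Torus) : ℝ≥0∞ :=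
  (∑' k : Fin 2 → ℤ,
    ENNReal.ofReal ((1 + freqNorm k ^ 2) ^ r * ‖torusCoeff g k‖ ^ 2)) ^ (1 / 2 : ℝ)

/-- The norm of `L^p(0, T; H^r(𝕋²))`, possibly `∞`. -/
def bochnerNorm (p : ℝ≥0∞) (r T : ℝ) (v : ℝ → L2Torus) : ℝ≥0∞ :=
  eLpNorm (fun t => sobolevNorm r (v t)) p (volume.restrict (Ioo 0 T))

/-- Membership in `L^p(0, T; H^r(𝕋²))`, for `r ≥ 0`. -/
def MemBochner (p : ℝ≥0∞) (r T : ℝ) (v : ℝ → L2Torus) : Prop :=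
  AEStronglyMeasurable v (volume.restrict (Ioo 0 T)) ∧ bochnerNorm p r T v < ⊤

/-! Test functions and derivatives -/

/-- Smooth real functions on the torus. -/
def SmoothOnTorus (g : Torus → ℝ) : Prop :=
  ContDiff ℝ ∞ fun x : Fin 2 → ℝ => g (toTorus x)

/-- `φ ∈ C_c^∞(I × 𝕋²)` for an open set `I` of times, extended by zero to all times. -/
def IsTestFunction (I : Set ℝ) (φ : ℝ → Torus → ℝ) : Prop :=
  ContDiff ℝ ∞ (fun p : ℝ × (Fin 2 → ℝ) => φ p.1 (toTorus p.2)) ∧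
    HasCompactSupport (Function.uncurry φ) ∧
    tsupport (Function.uncurry φ) ⊆ I ×ˢ univ

/-- The classical partial derivative `∂_j g` on the torus. -/
def partialDeriv (j : Fin 2) (g : Torus → ℝ) (x : Torus) : ℝ :=
  deriv (fun h : ℝ => g (x + Pi.single j (h : UnitAddCircle))) 0

/-- `v` is the weak partial derivative `∂_j g` on the torus. -/
def IsWeakPartial (j : Fin 2) (g v : Torus → ℝ) : Prop :=
  Integrable g torusMeasure ∧ Integrable v torusMeasure ∧
    ∀ ψ : Torus → ℝ, SmoothOnTorus ψ →
      ∫ x, g x * partialDeriv j ψ x ∂torusMeasure = -∫ x, v x * ψ x ∂torusMeasure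

/-- The fractional Laplacian `(-Δ)^r g = ∑_k |2πk|^{2r} ĝ(k) e^{2πi k·x}` of a smooth real
function `g`. The series converges absolutely and its sum is real. -/
def fracLaplacian (r : ℝ) (g : Torus → ℝ) (x : Torus) : ℝ :=
  (∑' k : Fin 2 → ℤ, (((2 * Real.pi * freqNorm k) ^ (2 * r) : ℝ) : ℂ) *
    torusCoeff g k * UnitAddTorus.mFourier k x).re

/-! The drift velocity -/

/-- The operator `𝒦g = K * g`. -/
def kernelConv (K g : Torus → ℝ) (x : Torus) : ℝ :=
  ∫ y, K (x - y) * g y ∂torusMeasure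

/-- `u = ℛg`, that is, `u = (-∂₂(𝒦g), ∂₁(𝒦g))` with weak derivatives. The coordinates, numbered
1 and 2 in this formula, are numbered 0 and 1 in `Fin 2`. -/
def IsVelocity (K g : Torus → ℝ) (u : Fin 2 → Torus → ℝ) : Prop :=
  IsWeakPartial 1 (kernelConv K g) (fun x => -u 0 x) ∧
    IsWeakPartial 0 (kernelConv K g) (u 1)

/-- The standing assumptions on the kernel `K` and on the operator `ℛ` that it generates. -/
structure IsAdmissibleKernel (K : Torus → ℝ) : Prop where
  integrable : Integrable K torusMeasure
  smooth : ContDiffOn ℝ ∞ (fun x : Fin 2 → ℝ => K (toTorus x)) {x | toTorus x ≠ 0}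
  coeff_bounds : ∃ c C : ℝ, 0 < c ∧ 0 < C ∧ ∀ k : Fin 2 → ℤ, k ≠ 0 →
    (torusCoeff K k).im = 0 ∧
      c * (freqNorm k)⁻¹ ≤ (torusCoeff K k).re ∧
      (torusCoeff K k).re ≤ C * (freqNorm k)⁻¹
  bounded_Lp : ∀ p : ℝ≥0∞, 1 < p → p < ⊤ → ∃ C : ℝ≥0, ∀ g : Torus → ℝ,
    MemLp g p torusMeasure → ∃ u : Fin 2 → Torus → ℝ, IsVelocity K g u ∧
      ∀ j, MemLp (u j) p torusMeasure ∧
        eLpNorm (u j) p torusMeasure ≤ C * eLpNorm g p torusMeasure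

/-! The equations -/

/-- `v` is a weak solution of `∂_t v + (-Δ)^α v = F` on `𝕋² × (0, T)` with `v(0) = 0`. The test
functions need not vanish at time `0`, which is how the initial condition enters. -/
def SolvesWeakly (α T : ℝ) (F : ℝ → Torus → ℝ) (v : ℝ → L2Torus) : Prop :=
  ∀ φ : ℝ → Torus → ℝ, IsTestFunction (Iio T) φ →
    ∫ t in Ioo 0 T, ∫ x, (-(v t x * deriv (fun τ => φ τ x) t) +
        v t x * fracLaplacian α (φ t) x) ∂torusMeasure =
      ∫ t in Ioo 0 T, ∫ x, F t x * φ t x ∂torusMeasure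

/-- `w` is the solution of the linear problem `∂_t w + (-Δ)^α w = f`, `w(0) = 0`, in
`L²(0, T; H^α) ∩ C([0, T]; L²)`. -/
structure IsLinearSolution (α T : ℝ) (f : ℝ → Torus → ℝ) (w : ℝ → L2Torus) : Prop where
  memL2 : MemBochner 2 α T w
  continuousOn : ContinuousOn w (Icc 0 T)
  initial : w 0 = 0
  solves : SolvesWeakly α T f w

/-- `θ` is the solution of the active scalar equation `∂_t θ + ℛθ·∇θ + (-Δ)^α θ = f`,
`θ(0) = 0`, in `L^∞(0, T; H^s) ∩ L²(0, T; H^{s+α})`. Here `u` is the velocity `ℛθ` and `G` is the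
weak gradient `∇θ`. -/
structure IsActiveScalarSolution (α s T : ℝ) (K : Torus → ℝ) (f : ℝ → Torus → ℝ)
    (θ : ℝ → L2Torus) : Prop where
  memLinfty : MemBochner ⊤ s T θ
  memL2 : MemBochner 2 (s + α) T θ
  solves : ∃ u G : ℝ → Fin 2 → Torus → ℝ,
    (∀ᵐ t ∂volume.restrict (Ioo 0 T),
      IsVelocity K (θ t) (u t) ∧ ∀ j, IsWeakPartial j (θ t) (G t j)) ∧
    SolvesWeakly α T (fun t x => f t x - ∑ j, u t j x * G t j x) θ

/-- `v_ε → v` in `L²(0, T; H^{2α}) ∩ L^∞(0, T; H^α)` as `ε → 0`, `ε ≠ 0`. -/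
def ConvergesTo (α T : ℝ) (v : ℝ → ℝ → L2Torus) (v₀ : ℝ → L2Torus) : Prop :=
  Tendsto (fun ε => bochnerNorm 2 (2 * α) T fun t => v ε t - v₀ t) (𝓝[≠] 0) (𝓝 0) ∧
    Tendsto (fun ε => bochnerNorm ⊤ α T fun t => v ε t - v₀ t) (𝓝[≠] 0) (𝓝 0)

end ActiveScalar

end

open ActiveScalar

noncomputable section

namespace ActiveScalar

/-! ### Weighted sequence spaces -/

/-! Everything happens on the Fourier side. Each mode of a weak solution of `∂_t v + (-Δ)^α v = F`,
`v(0) = 0`, is given by Duhamel's formula (`ae_eq_duhamel_of_weak`, `torusCoeff_eq_duhamel`). The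
time integral of the heat kernel of mode `k` is at most a constant times `(1 + |k|²)^{-α}`, so a
forcing in `L²H^{s-α}` puts `v` in `L^∞H^s` and in `L²H^{s+α}`, on every interval `(0, t₀)` with a
constant depending only on `T` (`sobolevSq_le_energy`, `energy_le_energy`).

The symbol of `𝒦` has order `-1`, so `ℛ` costs no derivative and `ℛθ·∇θ` is a bilinear term with one
derivative on one factor. Since `s > 1` and `s + α - 1 > 1`, the coefficients of both `θ` and `∇θ`
are summable, and Young's inequality `ℓ¹ * ℓ² → ℓ²` bounds the term in `H^{s-α}` by the product of
the `H^s` and `H^{s+α}` norms of `θ` (`exists_sobolevSq_product_le`).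

Let `E(t)` be the squared `L²(0, t; H^{s-α})` norm of the total forcing `εf - ℛθ·∇θ`. The two
estimates give `E ≤ Cε² + C E²`. As `E` is continuous and `E(0) = 0`, for small `ε` it cannot cross
the gap in this inequality, so `E(T) = O(ε²)` (`lintegral_le_of_quadratic`, `energy_forcing_le`).
Hence the transport term has norm `O(ε²)`. The difference `θ/ε - w` solves the heat equation with
forcing `-ε⁻¹ ℛθ·∇θ`, of norm `O(ε)`, and the parabolic estimate gives the limit with rate `O(ε)`
(`convergesLinearly_of_solutions`).

Each nonlinear solution is compared only with a linear one, so uniqueness for the nonlinear equation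
plays no role. The second limit is a difference of two instances of the first. -/

/-- Frequencies. -/
abbrev Freq : Type := Fin 2 → ℤ

/-- The Sobolev weight `(1 + |k|²)^r`. -/
def sobolevWeight (r : ℝ) (k : Freq) : ℝ≥0∞ := ENNReal.ofReal ((1 + freqNorm k ^ 2) ^ r)

/-- The squared `H^r` norm of a sequence of Fourier coefficients. -/
def sobolevSq (r : ℝ) (a : Freq → ℂ) : ℝ≥0∞ := ∑' k, sobolevWeight r k * ‖a k‖ₑ ^ 2

lemma freqNorm_sq (k : Freq) : freqNorm k ^ 2 = (k 0 : ℝ) ^ 2 + (k 1 : ℝ) ^ 2 := by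
  rw [freqNorm, Real.sq_sqrt (Finset.sum_nonneg fun i _ => sq_nonneg _), Fin.sum_univ_two]

lemma freqNorm_nonneg (k : Freq) : 0 ≤ freqNorm k := Real.sqrt_nonneg _

lemma one_le_weight_base (k : Freq) : 1 ≤ 1 + freqNorm k ^ 2 := by
  linarith [sq_nonneg (freqNorm k)]

lemma weight_base_pos (k : Freq) : 0 < 1 + freqNorm k ^ 2 := by
  linarith [sq_nonneg (freqNorm k)]

lemma one_le_freqNorm {k : Freq} (hk : k ≠ 0) : 1 ≤ freqNorm k := by
  have h : 1 ≤ freqNorm k ^ 2 := by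
    have h2 : ∃ i, k i ≠ 0 := by
      by_contra! h
      exact hk (funext h)
    have hsq : ∀ i, k i ≠ 0 → (1 : ℝ) ≤ (k i : ℝ) ^ 2 := fun i hi => by
      have : 1 ≤ k i ^ 2 := Int.add_one_le_iff.mpr (sq_pos_iff.mpr hi)
      exact_mod_cast this
    rw [freqNorm_sq]
    obtain ⟨i, hi⟩ := h2
    have := hsq i hi
    fin_cases i
    · simp only [Fin.zero_eta] at this; nlinarith [sq_nonneg (k 1 : ℝ)]
    · simp only [Fin.mk_one] at this; nlinarith [sq_nonneg (k 0 : ℝ)]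
  nlinarith [freqNorm_nonneg k]

lemma abs_coord_le_freqNorm (k : Freq) (j : Fin 2) : |(k j : ℝ)| ≤ freqNorm k := by
  refine Real.abs_le_sqrt ?_
  exact Finset.single_le_sum (f := fun i => (k i : ℝ) ^ 2) (fun i _ => sq_nonneg _)
    (Finset.mem_univ j)

lemma sobolevWeight_ne_top (r : ℝ) (k : Freq) : sobolevWeight r k ≠ ⊤ := ENNReal.ofReal_ne_top

lemma sobolevWeight_ne_zero (r : ℝ) (k : Freq) : sobolevWeight r k ≠ 0 := by
  rw [sobolevWeight, Ne, ENNReal.ofReal_eq_zero, not_le]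
  exact Real.rpow_pos_of_pos (weight_base_pos k) r

lemma sobolevWeight_add (r q : ℝ) (k : Freq) :
    sobolevWeight (r + q) k = sobolevWeight r k * sobolevWeight q k := by
  rw [sobolevWeight, sobolevWeight, sobolevWeight, ← ENNReal.ofReal_mul, Real.rpow_add]
  · exact weight_base_pos k
  · exact Real.rpow_nonneg (weight_base_pos k).le r

lemma sobolevWeight_half_sq (r : ℝ) (k : Freq) :
    sobolevWeight (r / 2) k ^ 2 = sobolevWeight r k := by
  rw [sq, ← sobolevWeight_add, add_halves]

lemma sobolevWeight_mono {r q : ℝ} (h : r ≤ q) (k : Freq) :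
    sobolevWeight r k ≤ sobolevWeight q k :=
  ENNReal.ofReal_le_ofReal (Real.rpow_le_rpow_of_exponent_le (one_le_weight_base k) h)

lemma sobolevWeight_zero (k : Freq) : sobolevWeight 0 k = 1 := by simp [sobolevWeight]

lemma sobolevSq_mono {r q : ℝ} (h : r ≤ q) (a : Freq → ℂ) : sobolevSq r a ≤ sobolevSq q a :=
  ENNReal.tsum_le_tsum fun k => by gcongr; exact sobolevWeight_mono h k

lemma sobolevNorm_eq (r : ℝ) (g : L2Torus) :
    sobolevNorm r g = sobolevSq r (torusCoeff g) ^ (1 / 2 : ℝ) := by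
  rw [sobolevNorm, sobolevSq]
  congr 1
  refine tsum_congr fun k => ?_
  rw [ENNReal.ofReal_mul (Real.rpow_nonneg (weight_base_pos k).le r),
    ENNReal.ofReal_pow (norm_nonneg _), ofReal_norm, sobolevWeight]

lemma sobolevNorm_sq (r : ℝ) (g : L2Torus) :
    sobolevNorm r g ^ 2 = sobolevSq r (torusCoeff g) := by
  rw [sobolevNorm_eq, ← ENNReal.rpow_natCast, ← ENNReal.rpow_mul]
  norm_num

lemma ennreal_add_sq_le (x y : ℝ≥0∞) : (x + y) ^ 2 ≤ 2 * x ^ 2 + 2 * y ^ 2 := by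
  have := ENNReal.rpow_add_le_mul_rpow_add_rpow x y (p := 2) (by norm_num)
  norm_num at this
  rw [mul_add] at this
  exact this

lemma sobolevSq_add_le (r : ℝ) (a b : Freq → ℂ) :
    sobolevSq r (fun k => a k + b k) ≤ 2 * sobolevSq r a + 2 * sobolevSq r b := by
  simp only [sobolevSq]
  rw [← ENNReal.tsum_mul_left, ← ENNReal.tsum_mul_left, ← ENNReal.tsum_add]
  refine ENNReal.tsum_le_tsum fun k => ?_
  calc sobolevWeight r k * ‖a k + b k‖ₑ ^ 2
      ≤ sobolevWeight r k * (2 * ‖a k‖ₑ ^ 2 + 2 * ‖b k‖ₑ ^ 2) := by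
        gcongr
        exact (pow_le_pow_left' (enorm_add_le _ _) 2).trans (ennreal_add_sq_le _ _)
    _ = _ := by ring

lemma sobolevSq_const_mul (r : ℝ) (c : ℂ) (a : Freq → ℂ) :
    sobolevSq r (fun k => c * a k) = ‖c‖ₑ ^ 2 * sobolevSq r a := by
  simp only [sobolevSq, ← ENNReal.tsum_mul_left, enorm_mul, mul_pow]
  exact tsum_congr fun k => by ring

lemma sobolevSq_neg (r : ℝ) (a : Freq → ℂ) : sobolevSq r (fun k => -a k) = sobolevSq r a := by
  simp [sobolevSq]

/-! ### Convolution inequalities and the Sobolev product estimate. -/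

/-- The Cauchy-Schwarz inequality behind Young's inequality for convolutions. -/
lemma lintegral_mul_sq_le {X : Type*} [MeasurableSpace X] {μ : Measure X} {g h : X → ℝ≥0∞}
    (hg : AEMeasurable g μ) (hh : AEMeasurable h μ) :
    (∫⁻ x, g x * h x ∂μ) ^ 2 ≤ (∫⁻ x, g x ∂μ) * ∫⁻ x, g x * h x ^ 2 ∂μ := by
  -- Hölder with exponents `2, 2` for the splitting `g h = √g · (√g h)`.
  have key := ENNReal.lintegral_mul_le_Lp_mul_Lq μ (p := 2) (q := 2)
    (by rw [Real.holderConjugate_iff]; norm_num)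
    (f := fun x => g x ^ (1 / 2 : ℝ)) (g := fun x => g x ^ (1 / 2 : ℝ) * h x)
    (hg.pow_const _) ((hg.pow_const _).mul hh)
  have e : ∀ x : ℝ≥0∞, x ^ (1 / 2 : ℝ) * x ^ (1 / 2 : ℝ) = x := fun x => by
    rw [← ENNReal.rpow_add_of_nonneg _ _ (by norm_num) (by norm_num)]; norm_num
  have e2 : ∀ x : ℝ≥0∞, (x ^ (1 / 2 : ℝ)) ^ 2 = x := fun x => by rw [sq, e]
  simp only [Pi.mul_apply, ← mul_assoc, e, ENNReal.rpow_two, mul_pow, e2] at key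
  calc _ ≤ _ := pow_le_pow_left' key 2
    _ = _ := by rw [mul_pow, e2, e2]

lemma tsum_mul_sq_le {ι : Type*} (g h : ι → ℝ≥0∞) :
    (∑' i, g i * h i) ^ 2 ≤ (∑' i, g i) * ∑' i, g i * h i ^ 2 := by
  -- A sum is an integral against counting measure, and for the discrete σ-algebra measurability is
  -- free.
  let _ : MeasurableSpace ι := ⊤
  have := lintegral_mul_sq_le (μ := Measure.count) (g := g) (h := h)
    measurable_from_top.aemeasurable measurable_from_top.aemeasurable
  simpa only [lintegral_count] using this

/-- Young's inequality `ℓ¹ * ℓ² → ℓ²`. -/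
lemma tsum_conv_sq_le (g h : Freq → ℝ≥0∞) :
    ∑' k, (∑' l, g l * h (k - l)) ^ 2 ≤ (∑' k, g k) ^ 2 * ∑' k, h k ^ 2 := by
  calc ∑' k, (∑' l, g l * h (k - l)) ^ 2
      ≤ ∑' k, (∑' l, g l) * ∑' l, g l * h (k - l) ^ 2 :=
        ENNReal.tsum_le_tsum fun k => tsum_mul_sq_le g fun l => h (k - l)
    _ = (∑' l, g l) * ∑' l, ∑' k, g l * h (k - l) ^ 2 := by
        rw [ENNReal.tsum_mul_left, ENNReal.tsum_comm]
    _ = (∑' l, g l) * ∑' l, g l * ∑' k, h k ^ 2 := by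
        congr 1
        refine tsum_congr fun l => ?_
        rw [ENNReal.tsum_mul_left]
        congr 1
        exact (Equiv.subRight l).tsum_eq fun k => h k ^ 2
    _ = _ := by rw [ENNReal.tsum_mul_right]; ring

/-- The reflection `l ↦ k - l` exchanges the factors. Both versions are needed because either factor
of the transport term may be the one placed in `ℓ¹`. -/
lemma tsum_conv_sq_le' (g h : Freq → ℝ≥0∞) :
    ∑' k, (∑' l, g l * h (k - l)) ^ 2 ≤ (∑' k, h k) ^ 2 * ∑' k, g k ^ 2 := by
  refine le_trans (le_of_eq ?_) (tsum_conv_sq_le h g)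
  refine tsum_congr fun k => ?_
  congr 1
  rw [← (Equiv.subLeft k).tsum_eq fun l => g l * h (k - l)]
  refine tsum_congr fun l => ?_
  simp [mul_comm]

/-- A substitute for the Leibniz rule: the weight of the output frequency falls on one of the two
input frequencies. The base inequality comes from `2|l|² + 2|k-l|² - |k|² = |k - 2l|² ≥ 0`. -/
lemma sobolevWeight_le_add {r : ℝ} (hr : 0 ≤ r) (k l : Freq) :
    sobolevWeight r k ≤
      ENNReal.ofReal (4 ^ r) * (sobolevWeight r l + sobolevWeight r (k - l)) := by
  rw [sobolevWeight, sobolevWeight, sobolevWeight, ← ENNReal.ofReal_add, ← ENNReal.ofReal_mul]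
  rotate_left
  · positivity
  · exact Real.rpow_nonneg (weight_base_pos _).le _
  · exact Real.rpow_nonneg (weight_base_pos _).le _
  refine ENNReal.ofReal_le_ofReal ?_
  have hmax : 1 + freqNorm k ^ 2 ≤ 4 * max (1 + freqNorm l ^ 2) (1 + freqNorm (k - l) ^ 2) := by
    have h : 1 + freqNorm k ^ 2 ≤ 2 * (1 + freqNorm l ^ 2) + 2 * (1 + freqNorm (k - l) ^ 2) := by
      simp only [freqNorm_sq, Pi.sub_apply, Int.cast_sub]
      nlinarith [sq_nonneg ((k 0 : ℝ) - 2 * l 0), sq_nonneg ((k 1 : ℝ) - 2 * l 1)]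
    linarith [le_max_left (1 + freqNorm l ^ 2) (1 + freqNorm (k - l) ^ 2),
      le_max_right (1 + freqNorm l ^ 2) (1 + freqNorm (k - l) ^ 2)]
  calc (1 + freqNorm k ^ 2) ^ r
      ≤ (4 * max (1 + freqNorm l ^ 2) (1 + freqNorm (k - l) ^ 2)) ^ r :=
        Real.rpow_le_rpow (weight_base_pos k).le hmax hr
    _ = 4 ^ r * (max (1 + freqNorm l ^ 2) (1 + freqNorm (k - l) ^ 2)) ^ r :=
        Real.mul_rpow (by norm_num) ((weight_base_pos l).le.trans (le_max_left _ _))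
    _ ≤ _ := by
        gcongr
        rcases max_cases (1 + freqNorm l ^ 2) (1 + freqNorm (k - l) ^ 2) with h | h <;> rw [h.1]
        · exact le_add_of_nonneg_right (Real.rpow_nonneg (weight_base_pos _).le _)
        · exact le_add_of_nonneg_left (Real.rpow_nonneg (weight_base_pos _).le _)

/-- The weight is at most `‖k‖^{-2r}` in the sup norm for `k ≠ 0`, and this lattice sum over `ℤ²`
converges for `2r > 2`. -/
lemma tsum_sobolevWeight_lt_top {r : ℝ} (hr : 1 < r) : ∑' k, sobolevWeight (-r) k < ⊤ := by
  have h := EisensteinSeries.summable_one_div_norm_rpow (k := 2 * r) (by linarith)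
  have hs : Summable fun k : Freq => (1 + freqNorm k ^ 2) ^ (-r) := by
    refine Summable.of_norm_bounded_eventually h ?_
    have : ∀ᶠ k : Freq in cofinite, k ≠ 0 := (finite_singleton 0).compl_mem_cofinite
    filter_upwards [this] with k hk
    have hk0 : 0 < ‖k‖ := norm_pos_iff.mpr hk
    have hle : ‖k‖ ≤ freqNorm k := by
      refine (pi_norm_le_iff_of_nonneg (freqNorm_nonneg k)).mpr fun j => ?_
      rw [Int.norm_eq_abs]
      exact abs_coord_le_freqNorm k j
    rw [Real.norm_of_nonneg (Real.rpow_nonneg (weight_base_pos k).le _),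
      show -(2 * r) = 2 * (-r) by ring, Real.rpow_mul hk0.le, Real.rpow_two]
    exact Real.rpow_le_rpow_of_nonpos (by positivity) (by nlinarith) (by linarith)
  exact hs.tsum_ofReal_lt_top

/-- The Sobolev embedding `H^r → ℱℓ¹`, `r > 1`. -/
lemma sq_tsum_le_sobolevSq (r : ℝ) (a : Freq → ℂ) :
    (∑' k, ‖a k‖ₑ) ^ 2 ≤ (∑' k, sobolevWeight (-r) k) * sobolevSq r a := by
  have := tsum_mul_sq_le (fun k => sobolevWeight (-r) k) fun k => sobolevWeight r k * ‖a k‖ₑ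
  have e : ∀ k : Freq, sobolevWeight (-r) k * sobolevWeight r k = 1 := fun k => by
    rw [← sobolevWeight_add, neg_add_cancel, sobolevWeight_zero]
  simp only [mul_pow, ← mul_assoc, e, one_mul] at this
  refine this.trans (le_of_eq ?_)
  congr 1
  refine tsum_congr fun k => ?_
  rw [sq (sobolevWeight r k), ← mul_assoc, e, one_mul]

lemma sobolevSq_half_weight (r : ℝ) (a : Freq → ℂ) :
    ∑' k, (sobolevWeight (r / 2) k * ‖a k‖ₑ) ^ 2 = sobolevSq r a := by
  simp only [mul_pow, sobolevWeight_half_sq, sobolevSq]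

/-- The bilinear estimate: with one derivative on one of the factors, the product of two sequences
is bounded in `H^{s-α}` by the `H^s` and the `H^{s+α}` norm. -/
lemma exists_sobolevSq_product_le {α s : ℝ} (hα : 1 / 2 < α) (hα' : α < 1) (hs : 2 < s + α) :
    ∃ C : ℝ≥0∞, C ≠ ⊤ ∧ ∀ (a N : Freq → ℂ) (c : ℝ≥0∞),
      (∀ k, ‖N k‖ₑ ≤ c * ∑' l, ‖a l‖ₑ * (sobolevWeight (1 / 2) (k - l) * ‖a (k - l)‖ₑ)) →
      sobolevSq (s - α) N ≤ c ^ 2 * C * (sobolevSq s a * sobolevSq (s + α) a) := by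
  set r := s - α with hr
  set D : ℝ≥0∞ := ENNReal.ofReal (4 ^ (r / 2)) with hD
  set S₁ : ℝ≥0∞ := ∑' k, sobolevWeight (-(s + α - 1)) k with hS₁
  set S₂ : ℝ≥0∞ := ∑' k, sobolevWeight (-s) k with hS₂
  have hr0 : 0 ≤ r / 2 := by rw [hr]; linarith
  refine ⟨D ^ 2 * (2 * S₁ + 2 * S₂), ?_, fun a N c hN => ?_⟩
  · have h1 : S₁ ≠ ⊤ := (tsum_sobolevWeight_lt_top (by linarith)).ne
    have h2 : S₂ ≠ ⊤ := (tsum_sobolevWeight_lt_top (by linarith)).ne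
    have h3 : D ≠ ⊤ := ENNReal.ofReal_ne_top
    finiteness
  set A : Freq → ℝ≥0∞ := fun k => ‖a k‖ₑ with hA
  set B : Freq → ℝ≥0∞ := fun k => sobolevWeight (1 / 2) k * ‖a k‖ₑ with hB
  set W : Freq → ℝ≥0∞ := sobolevWeight (r / 2) with hW
  -- `B` carries the coefficients of the differentiated factor; one derivative is lost from
  -- `H^{s+α}`, and `s + α - 1 > 1` still makes `B` summable.
  have hB1 : (∑' k, B k) ^ 2 ≤ S₁ * sobolevSq (s + α) a := by
    have := tsum_mul_sq_le (fun k => sobolevWeight (-(s + α - 1)) k)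
      fun k => sobolevWeight (s + α - 1) k * B k
    have e : ∀ k : Freq, sobolevWeight (-(s + α - 1)) k * sobolevWeight (s + α - 1) k = 1 :=
      fun k => by rw [← sobolevWeight_add, neg_add_cancel, sobolevWeight_zero]
    simp only [mul_pow, ← mul_assoc, e, one_mul] at this
    refine this.trans (le_of_eq ?_)
    congr 1
    refine tsum_congr fun k => ?_
    rw [sq (sobolevWeight (s + α - 1) k), ← mul_assoc, e, one_mul, hB]
    simp only [mul_pow]
    rw [sobolevWeight_half_sq, ← mul_assoc, ← sobolevWeight_add]
    congr 2
    ring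
  have hA1 : (∑' k, A k) ^ 2 ≤ S₂ * sobolevSq s a := sq_tsum_le_sobolevSq s a
  have hWA : ∑' k, (W k * A k) ^ 2 ≤ sobolevSq s a := by
    rw [hW, hA, sobolevSq_half_weight]
    exact sobolevSq_mono (by rw [hr]; linarith) a
  -- Here `α > 1/2` enters: the total order `s - α + 1` must not exceed `s + α`.
  have hWB : ∑' k, (W k * B k) ^ 2 ≤ sobolevSq (s + α) a := by
    have : ∀ k, W k * B k = sobolevWeight ((r + 1) / 2) k * ‖a k‖ₑ := fun k => by
      rw [hW, hB]
      simp only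
      rw [← mul_assoc, ← sobolevWeight_add]
      congr 2
      ring
    simp only [this]
    rw [sobolevSq_half_weight]
    exact sobolevSq_mono (by rw [hr]; linarith) a
  -- The weight is distributed over the factors: when it falls on `A`, the factor `B` is summed in
  -- `ℓ¹`, and when it falls on `B`, the factor `A` is.
  have hpt : ∀ k, sobolevWeight r k * ‖N k‖ₑ ^ 2 ≤ c ^ 2 * D ^ 2 *
      (2 * (∑' l, (W l * A l) * B (k - l)) ^ 2 + 2 * (∑' l, A l * (W (k - l) * B (k - l))) ^ 2) := by
    intro k
    have h1 : W k * ∑' l, A l * B (k - l) ≤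
        D * (∑' l, (W l * A l) * B (k - l) + ∑' l, A l * (W (k - l) * B (k - l))) := by
      rw [← ENNReal.tsum_mul_left, ← ENNReal.tsum_add, ← ENNReal.tsum_mul_left]
      refine ENNReal.tsum_le_tsum fun l => ?_
      calc W k * (A l * B (k - l)) ≤ (D * (W l + W (k - l))) * (A l * B (k - l)) := by
            gcongr
            exact sobolevWeight_le_add hr0 k l
        _ = _ := by ring
    calc sobolevWeight r k * ‖N k‖ₑ ^ 2 = (W k * ‖N k‖ₑ) ^ 2 := by
          rw [mul_pow, hW, sobolevWeight_half_sq]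
      _ ≤ (W k * (c * ∑' l, A l * B (k - l))) ^ 2 := by
          gcongr
          exact hN k
      _ = (c * (W k * ∑' l, A l * B (k - l))) ^ 2 := by ring
      _ ≤ (c * (D * (∑' l, (W l * A l) * B (k - l) +
            ∑' l, A l * (W (k - l) * B (k - l))))) ^ 2 := by gcongr
      _ = c ^ 2 * D ^ 2 * (∑' l, (W l * A l) * B (k - l) +
            ∑' l, A l * (W (k - l) * B (k - l))) ^ 2 := by ring
      _ ≤ _ := by
          gcongr
          exact ennreal_add_sq_le _ _
  calc sobolevSq r N ≤ ∑' k, c ^ 2 * D ^ 2 * (2 * (∑' l, (W l * A l) * B (k - l)) ^ 2 +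
          2 * (∑' l, A l * (W (k - l) * B (k - l))) ^ 2) := ENNReal.tsum_le_tsum hpt
    _ = c ^ 2 * D ^ 2 * (2 * ∑' k, (∑' l, (W l * A l) * B (k - l)) ^ 2 +
          2 * ∑' k, (∑' l, A l * (W (k - l) * B (k - l))) ^ 2) := by
        rw [ENNReal.tsum_mul_left, ENNReal.tsum_add, ENNReal.tsum_mul_left, ENNReal.tsum_mul_left]
    _ ≤ c ^ 2 * D ^ 2 * (2 * ((∑' k, B k) ^ 2 * ∑' k, (W k * A k) ^ 2) +
          2 * ((∑' k, A k) ^ 2 * ∑' k, (W k * B k) ^ 2)) := by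
        gcongr
        · exact tsum_conv_sq_le' (fun l => W l * A l) B
        · exact tsum_conv_sq_le A fun l => W l * B l
    _ ≤ c ^ 2 * D ^ 2 * (2 * ((S₁ * sobolevSq (s + α) a) * sobolevSq s a) +
          2 * ((S₂ * sobolevSq s a) * sobolevSq (s + α) a)) := by gcongr
    _ = _ := by ring

end ActiveScalar

end

noncomputable section

namespace ActiveScalar

/-! ### The parabolic estimate -/

/-- The solution of `a' + λ a = F`, `a(0) = 0`. -/
def duhamel (lam : ℝ) (F : ℝ → ℂ) (t : ℝ) : ℂ :=
  ∫ τ in Ioo 0 t, (Real.exp (-(lam * (t - τ))) : ℂ) * F τ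

/-- The symbol of `(-Δ)^α`. -/
def heatRate (α : ℝ) (k : Freq) : ℝ := (2 * Real.pi * freqNorm k) ^ (2 * α)

/-- The squared norm of `L²(0, t; H^r)` of a time-dependent sequence of coefficients. -/
def energy (r : ℝ) (F : ℝ → Freq → ℂ) (t : ℝ) : ℝ≥0∞ := ∫⁻ τ in Ioo 0 t, sobolevSq r (F τ)

/-- The heat kernel of a single mode, cut off to `(0, T)`. -/
def modeKernel (lam T σ : ℝ) : ℝ≥0∞ :=
  (Ioo 0 T).indicator (fun σ => ENNReal.ofReal (Real.exp (-(lam * σ)))) σ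

lemma heatRate_nonneg (α : ℝ) (k : Freq) : 0 ≤ heatRate α k :=
  Real.rpow_nonneg (mul_nonneg (by positivity) (freqNorm_nonneg k)) _

lemma measurable_modeKernel (lam T : ℝ) : Measurable (modeKernel lam T) :=
  Measurable.indicator (by fun_prop) measurableSet_Ioo

lemma modeKernel_le_one {lam : ℝ} (hlam : 0 ≤ lam) (T σ : ℝ) : modeKernel lam T σ ≤ 1 := by
  by_cases hx : σ ∈ Ioo 0 T
  · rw [modeKernel, indicator_of_mem hx, ENNReal.ofReal_le_one, Real.exp_le_one_iff]
    have := mul_nonneg hlam hx.1.le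
    linarith
  · rw [modeKernel, indicator_of_notMem hx]; exact zero_le_one

lemma lintegral_modeKernel_le {lam : ℝ} (hlam : 0 ≤ lam) {T : ℝ} :
    ∫⁻ σ, modeKernel lam T σ ≤ ENNReal.ofReal T := by
  calc ∫⁻ σ, modeKernel lam T σ ≤ ∫⁻ σ, (Ioo 0 T).indicator (fun _ => 1) σ := by
        refine lintegral_mono fun σ => ?_
        by_cases h : σ ∈ Ioo 0 T
        · rw [indicator_of_mem h]; exact modeKernel_le_one hlam T σ
        · rw [modeKernel, indicator_of_notMem h]; exact zero_le
    _ = ENNReal.ofReal T := by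
        rw [lintegral_indicator measurableSet_Ioo]
        simp

lemma lintegral_modeKernel_le_inv {lam : ℝ} (hlam : 0 < lam) {T : ℝ} :
    ∫⁻ σ, modeKernel lam T σ ≤ ENNReal.ofReal lam⁻¹ := by
  have hint : ∫ x in Ioi (0 : ℝ), Real.exp (-(lam * x)) = lam⁻¹ := by
    have := integral_exp_mul_Ioi (neg_lt_zero.mpr hlam) 0
    simp only [neg_mul] at this
    rw [this]
    simp
  have hi : IntegrableOn (fun x => Real.exp (-(lam * x))) (Ioi (0 : ℝ)) := by
    have := integrableOn_exp_mul_Ioi (neg_lt_zero.mpr hlam) 0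
    simpa only [neg_mul] using this
  unfold modeKernel
  rw [lintegral_indicator measurableSet_Ioo, ← hint,
    ofReal_integral_eq_lintegral_ofReal hi (ae_of_all _ fun x => (Real.exp_pos _).le)]
  exact lintegral_mono_set Ioo_subset_Ioi_self

/-- The smoothing of the heat flow. Modes `k ≠ 0` use the kernel mass `λ⁻¹` and `4π²|k|² ≥ 1 +
|k|²`. The mode `k = 0` is not damped and uses the mass `T`, which is the source of `1 + T`. -/
lemma sobolevWeight_mul_lintegral_modeKernel_le {α T : ℝ} (hα : 0 < α) (hT : 0 ≤ T) (k : Freq) :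
    sobolevWeight α k * ∫⁻ σ, modeKernel (heatRate α k) T σ ≤ ENNReal.ofReal (1 + T) := by
  rcases eq_or_ne k 0 with rfl | hk
  · have : sobolevWeight α (0 : Freq) = 1 := by
      simp [sobolevWeight, freqNorm]
    rw [this, one_mul]
    exact (lintegral_modeKernel_le (heatRate_nonneg _ _)).trans
      (ENNReal.ofReal_le_ofReal (by linarith))
  · have h1 := one_le_freqNorm hk
    have hb : 0 < 2 * Real.pi * freqNorm k := by positivity
    have hpos : 0 < heatRate α k := Real.rpow_pos_of_pos hb _
    refine le_trans (mul_le_mul_right (lintegral_modeKernel_le_inv hpos) _) ?_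
    rw [sobolevWeight, ← ENNReal.ofReal_mul (Real.rpow_nonneg (weight_base_pos k).le _)]
    refine ENNReal.ofReal_le_ofReal ?_
    refine le_trans ?_ (le_add_of_nonneg_right hT)
    rw [← div_eq_mul_inv, div_le_one hpos, heatRate, Real.rpow_mul hb.le, Real.rpow_two]
    refine Real.rpow_le_rpow (weight_base_pos k).le ?_ hα.le
    nlinarith [Real.pi_gt_three, mul_pos (sub_pos.mpr Real.pi_gt_three) (by linarith : 0 < freqNorm k)]

/-- The pointwise bound for Duhamel's formula. -/
lemma enorm_duhamel_sq_le (lam : ℝ) {F : ℝ → ℂ} {T t t₀ : ℝ} (ht : t ≤ t₀) (ht₀ : t₀ ≤ T)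
    (hF : AEMeasurable F (volume.restrict (Ioo 0 T))) :
    ‖duhamel lam F t‖ₑ ^ 2 ≤ (∫⁻ σ, modeKernel lam T σ) *
      ∫⁻ τ in Ioo 0 t₀, modeKernel lam T (t - τ) * ‖F τ‖ₑ ^ 2 := by
  have hF' : AEMeasurable F (volume.restrict (Ioo 0 t₀)) :=
    hF.mono_measure (Measure.restrict_mono (Ioo_subset_Ioo_right ht₀) le_rfl)
  have hk : Measurable fun τ => modeKernel lam T (t - τ) :=
    (measurable_modeKernel lam T).comp (by fun_prop)
  have h1 : ‖duhamel lam F t‖ₑ ≤ ∫⁻ τ in Ioo 0 t₀, modeKernel lam T (t - τ) * ‖F τ‖ₑ := by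
    refine (enorm_integral_le_lintegral_enorm _).trans ?_
    -- The cut-off kernel vanishes at negative arguments, so the integral may run over `(0, t₀)`, a
    -- domain independent of `t`.
    refine le_trans ?_ (lintegral_mono_set (Ioo_subset_Ioo_right ht))
    refine setLIntegral_mono' measurableSet_Ioo fun τ hτ => ?_
    have hmem : t - τ ∈ Ioo 0 T := ⟨by linarith [hτ.2], by linarith [hτ.1]⟩
    rw [enorm_mul, modeKernel, indicator_of_mem hmem, ← ofReal_norm (Complex.ofReal _),
      Complex.norm_real, Real.norm_of_nonneg (Real.exp_pos _).le]
  calc ‖duhamel lam F t‖ₑ ^ 2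
      ≤ (∫⁻ τ in Ioo 0 t₀, modeKernel lam T (t - τ) * ‖F τ‖ₑ) ^ 2 := by gcongr
    _ ≤ (∫⁻ τ in Ioo 0 t₀, modeKernel lam T (t - τ)) *
        ∫⁻ τ in Ioo 0 t₀, modeKernel lam T (t - τ) * ‖F τ‖ₑ ^ 2 :=
      lintegral_mul_sq_le hk.aemeasurable hF'.enorm
    _ ≤ _ := by
      refine mul_le_mul' ((setLIntegral_le_lintegral _ _).trans (le_of_eq ?_)) le_rfl
      exact lintegral_sub_left_eq_self (modeKernel lam T) t

/-- Of the two kernel factors one is bounded by `1` and one is integrated, so the pointwise bound in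
time gains `α` derivatives. -/
lemma enorm_duhamel_sq_le_lintegral {lam : ℝ} (hlam : 0 ≤ lam) {F : ℝ → ℂ} {T t t₀ : ℝ}
    (ht : t ≤ t₀) (ht₀ : t₀ ≤ T) (hF : AEMeasurable F (volume.restrict (Ioo 0 T))) :
    ‖duhamel lam F t‖ₑ ^ 2 ≤ (∫⁻ σ, modeKernel lam T σ) * ∫⁻ τ in Ioo 0 t₀, ‖F τ‖ₑ ^ 2 := by
  refine (enorm_duhamel_sq_le lam ht ht₀ hF).trans ?_
  gcongr with τ
  exact mul_le_of_le_one_left zero_le (modeKernel_le_one hlam _ _)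

/-- Young's inequality `L¹ * L² → L²` in time. Both kernel factors are integrated, which gains `2α`
derivatives. -/
lemma lintegral_enorm_duhamel_sq_le (lam : ℝ) {F : ℝ → ℂ} {T t₀ : ℝ} (ht₀ : t₀ ≤ T)
    (hF : AEMeasurable F (volume.restrict (Ioo 0 T))) :
    ∫⁻ t in Ioo 0 t₀, ‖duhamel lam F t‖ₑ ^ 2 ≤
      (∫⁻ σ, modeKernel lam T σ) ^ 2 * ∫⁻ τ in Ioo 0 t₀, ‖F τ‖ₑ ^ 2 := by
  have hF' : AEMeasurable F (volume.restrict (Ioo 0 t₀)) :=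
    hF.mono_measure (Measure.restrict_mono (Ioo_subset_Ioo_right ht₀) le_rfl)
  set κ := ∫⁻ σ, modeKernel lam T σ with hκ
  have hm : AEMeasurable (Function.uncurry fun t τ => modeKernel lam T (t - τ) * ‖F τ‖ₑ ^ 2)
      ((volume.restrict (Ioo 0 t₀)).prod (volume.restrict (Ioo 0 t₀))) := by
    have h1 : Measurable fun p : ℝ × ℝ => modeKernel lam T (p.1 - p.2) :=
      (measurable_modeKernel lam T).comp (by fun_prop)
    exact h1.aemeasurable.mul ((hF'.enorm.pow_const 2).comp_snd)
  -- The sign of `lam` is arbitrary here; this crude bound only serves to move `κ` through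
  -- integrals.
  have hκtop : κ ≠ ⊤ := by
    refine ne_top_of_le_ne_top (b := ENNReal.ofReal (T * Real.exp (|lam| * T)))
      ENNReal.ofReal_ne_top ?_
    rw [hκ]
    unfold modeKernel
    rw [lintegral_indicator measurableSet_Ioo]
    calc ∫⁻ σ in Ioo 0 T, ENNReal.ofReal (Real.exp (-(lam * σ)))
        ≤ ∫⁻ σ in Ioo 0 T, ENNReal.ofReal (Real.exp (|lam| * T)) := by
          refine setLIntegral_mono' measurableSet_Ioo fun σ hσ => ?_
          refine ENNReal.ofReal_le_ofReal (Real.exp_le_exp.mpr ?_)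
          nlinarith [neg_abs_le lam, abs_nonneg lam, hσ.1, hσ.2]
      _ ≤ _ := by
          rw [lintegral_const, Measure.restrict_apply_univ, Real.volume_Ioo, sub_zero, mul_comm,
            ENNReal.ofReal_mul' (Real.exp_pos _).le]
  calc ∫⁻ t in Ioo 0 t₀, ‖duhamel lam F t‖ₑ ^ 2
      ≤ ∫⁻ t in Ioo 0 t₀, κ * ∫⁻ τ in Ioo 0 t₀, modeKernel lam T (t - τ) * ‖F τ‖ₑ ^ 2 :=
        setLIntegral_mono' measurableSet_Ioo fun t ht =>
          enorm_duhamel_sq_le lam ht.2.le ht₀ hF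
    _ = κ * ∫⁻ τ in Ioo 0 t₀, ∫⁻ t in Ioo 0 t₀, modeKernel lam T (t - τ) * ‖F τ‖ₑ ^ 2 := by
        rw [lintegral_const_mul' _ _ hκtop, lintegral_lintegral_swap hm]
    _ ≤ κ * ∫⁻ τ in Ioo 0 t₀, κ * ‖F τ‖ₑ ^ 2 := by
        gcongr with τ
        have hk : Measurable fun t => modeKernel lam T (t - τ) :=
          (measurable_modeKernel lam T).comp (by fun_prop)
        rw [lintegral_mul_const _ hk]
        gcongr
        exact (setLIntegral_le_lintegral _ _).trans
          (le_of_eq (lintegral_sub_right_eq_self (modeKernel lam T) τ))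
    _ = _ := by rw [lintegral_const_mul' _ _ hκtop]; ring

lemma energy_eq_tsum (r : ℝ) {F : ℝ → Freq → ℂ} {T t₀ : ℝ} (ht₀ : t₀ ≤ T)
    (hF : ∀ k, AEMeasurable (fun t => F t k) (volume.restrict (Ioo 0 T))) :
    energy r F t₀ = ∑' k, sobolevWeight r k * ∫⁻ τ in Ioo 0 t₀, ‖F τ k‖ₑ ^ 2 := by
  have hF' : ∀ k, AEMeasurable (fun t => F t k) (volume.restrict (Ioo 0 t₀)) := fun k =>
    (hF k).mono_measure (Measure.restrict_mono (Ioo_subset_Ioo_right ht₀) le_rfl)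
  unfold energy sobolevSq
  rw [lintegral_tsum fun k => ((hF' k).enorm.pow_const 2).const_mul _]
  exact tsum_congr fun k => lintegral_const_mul' _ _ (sobolevWeight_ne_top r k)

/-- The parabolic estimate in `L^∞(0, t₀; H^s)`. -/
lemma sobolevSq_le_energy {α s T t t₀ : ℝ} (hα : 0 < α) (hT : 0 ≤ T) (ht : t ≤ t₀) (ht₀ : t₀ ≤ T)
    {F : ℝ → Freq → ℂ} (hF : ∀ k, AEMeasurable (fun t => F t k) (volume.restrict (Ioo 0 T)))
    {a : Freq → ℂ} (ha : ∀ k, a k = duhamel (heatRate α k) (fun τ => F τ k) t) :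
    sobolevSq s a ≤ ENNReal.ofReal (1 + T) * energy (s - α) F t₀ := by
  rw [energy_eq_tsum _ ht₀ hF, ← ENNReal.tsum_mul_left]
  refine ENNReal.tsum_le_tsum fun k => ?_
  rw [ha k]
  calc sobolevWeight s k * ‖duhamel (heatRate α k) (fun τ => F τ k) t‖ₑ ^ 2
      ≤ sobolevWeight s k * ((∫⁻ σ, modeKernel (heatRate α k) T σ) *
        ∫⁻ τ in Ioo 0 t₀, ‖F τ k‖ₑ ^ 2) := by
        gcongr
        exact enorm_duhamel_sq_le_lintegral (heatRate_nonneg α k) ht ht₀ (hF k)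
    _ = (sobolevWeight α k * ∫⁻ σ, modeKernel (heatRate α k) T σ) *
        (sobolevWeight (s - α) k * ∫⁻ τ in Ioo 0 t₀, ‖F τ k‖ₑ ^ 2) := by
        rw [show s = α + (s - α) by ring, sobolevWeight_add, add_sub_cancel_left]
        ring
    _ ≤ _ := by
        gcongr
        exact sobolevWeight_mul_lintegral_modeKernel_le hα hT k

/-- The parabolic estimate in `L²(0, t₀; H^{s+α})`. -/
lemma energy_le_energy {α s T t₀ : ℝ} (hα : 0 < α) (hT : 0 ≤ T) (ht₀ : t₀ ≤ T)
    {F a : ℝ → Freq → ℂ} (hF : ∀ k, AEMeasurable (fun t => F t k) (volume.restrict (Ioo 0 T)))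
    (hm : ∀ k, AEMeasurable (fun t => a t k) (volume.restrict (Ioo 0 T)))
    (ha : ∀ᵐ t ∂volume.restrict (Ioo 0 T), ∀ k,
      a t k = duhamel (heatRate α k) (fun τ => F τ k) t) :
    energy (s + α) a t₀ ≤ ENNReal.ofReal (1 + T) ^ 2 * energy (s - α) F t₀ := by
  rw [energy_eq_tsum _ ht₀ hF, energy_eq_tsum _ ht₀ hm, ← ENNReal.tsum_mul_left]
  refine ENNReal.tsum_le_tsum fun k => ?_
  have hak : ∀ᵐ t ∂volume.restrict (Ioo 0 t₀),
      ‖a t k‖ₑ ^ 2 = ‖duhamel (heatRate α k) (fun τ => F τ k) t‖ₑ ^ 2 := by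
    filter_upwards [ae_restrict_of_ae_restrict_of_subset (Ioo_subset_Ioo_right ht₀) ha] with t h
    rw [h k]
  rw [lintegral_congr_ae hak]
  calc sobolevWeight (s + α) k *
        ∫⁻ t in Ioo 0 t₀, ‖duhamel (heatRate α k) (fun τ => F τ k) t‖ₑ ^ 2
      ≤ sobolevWeight (s + α) k * ((∫⁻ σ, modeKernel (heatRate α k) T σ) ^ 2 *
        ∫⁻ τ in Ioo 0 t₀, ‖F τ k‖ₑ ^ 2) := by
        gcongr
        exact lintegral_enorm_duhamel_sq_le _ ht₀ (hF k)
    _ = (sobolevWeight α k * ∫⁻ σ, modeKernel (heatRate α k) T σ) ^ 2 *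
        (sobolevWeight (s - α) k * ∫⁻ τ in Ioo 0 t₀, ‖F τ k‖ₑ ^ 2) := by
        rw [show s + α = α + α + (s - α) by ring, sobolevWeight_add, sobolevWeight_add]
        ring
    _ ≤ _ := by
        gcongr
        exact sobolevWeight_mul_lintegral_modeKernel_le hα hT k

end ActiveScalar

end

noncomputable section

namespace ActiveScalar

/-! ### Uniqueness for the weak formulation of a single mode -/

/-- The solution of the backward problem `-η' + λ η = ψ`, `η(T) = 0`. -/
def backwardSol (lam T : ℝ) (ψ : ℝ → ℝ) (t : ℝ) : ℝ :=
  Real.exp (lam * t) * ∫ τ in t..T, Real.exp (-(lam * τ)) * ψ τ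

lemma hasDerivAt_backwardSol (lam T : ℝ) {ψ : ℝ → ℝ} (hψ : Continuous ψ) (t : ℝ) :
    HasDerivAt (backwardSol lam T ψ) (lam * backwardSol lam T ψ t - ψ t) t := by
  have hc : Continuous fun τ => Real.exp (-(lam * τ)) * ψ τ := by fun_prop
  have h1 : HasDerivAt (fun t => ∫ τ in t..T, Real.exp (-(lam * τ)) * ψ τ)
      (-(Real.exp (-(lam * t)) * ψ t)) t :=
    intervalIntegral.integral_hasDerivAt_left (hc.intervalIntegrable _ _)
      hc.aestronglyMeasurable.stronglyMeasurableAtFilter hc.continuousAt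
  have h2 : HasDerivAt (fun t => Real.exp (lam * t)) (Real.exp (lam * t) * (lam * 1)) t :=
    ((hasDerivAt_id t).const_mul lam).exp
  refine (h2.mul h1).congr_deriv ?_
  have h3 : Real.exp (lam * t) * Real.exp (-(lam * t)) = 1 := by rw [← Real.exp_add]; simp
  rw [backwardSol]
  linear_combination (-ψ t) * h3

lemma contDiff_backwardSol (lam T : ℝ) {ψ : ℝ → ℝ} (hψ : ContDiff ℝ ∞ ψ) :
    ContDiff ℝ ∞ (backwardSol lam T ψ) := by
  have hc : ContDiff ℝ ∞ fun τ => Real.exp (-(lam * τ)) * ψ τ := by fun_prop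
  have h1 : ContDiff ℝ ∞ (fun t => ∫ τ in t..T, Real.exp (-(lam * τ)) * ψ τ) := by
    have hd : ∀ t, HasDerivAt (fun t => ∫ τ in t..T, Real.exp (-(lam * τ)) * ψ τ)
        (-(Real.exp (-(lam * t)) * ψ t)) t := fun t =>
      intervalIntegral.integral_hasDerivAt_left (hc.continuous.intervalIntegrable _ _)
        hc.continuous.aestronglyMeasurable.stronglyMeasurableAtFilter hc.continuous.continuousAt
    rw [contDiff_infty_iff_deriv]
    refine ⟨fun t => (hd t).differentiableAt, ?_⟩
    rw [show deriv (fun t => ∫ τ in t..T, Real.exp (-(lam * τ)) * ψ τ) =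
      fun t => -(Real.exp (-(lam * t)) * ψ t) from funext fun t => (hd t).deriv]
    exact hc.neg
  unfold backwardSol
  fun_prop

/-! ### Duality between Duhamel's formula and the backward problem. -/

/-- Duhamel's formula as an integral against a kernel over the whole time interval. -/
def duhamelIntegrand (lam : ℝ) (F : ℝ → ℂ) (p : ℝ × ℝ) : ℂ :=
  {q : ℝ × ℝ | q.2 < q.1}.indicator (fun q => (Real.exp (-(lam * (q.1 - q.2))) : ℂ)) p * F p.2

lemma integrable_duhamelIntegrand (lam : ℝ) {T : ℝ} {F : ℝ → ℂ} {ψ : ℝ → ℝ}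
    (hψ : Continuous ψ) (hF : IntegrableOn F (Ioo 0 T)) :
    Integrable (fun p : ℝ × ℝ => (ψ p.1 : ℂ) * duhamelIntegrand lam F p)
      ((volume.restrict (Ioo 0 T)).prod (volume.restrict (Ioo 0 T))) := by
  have hψi : Integrable (fun t => (ψ t : ℂ)) (volume.restrict (Ioo 0 T)) :=
    ((Complex.continuous_ofReal.comp hψ).integrableOn_Icc (a := 0) (b := T)).mono_set
      Ioo_subset_Icc_self
  have hprod := hψi.mul_prod hF
  have hmeas : MeasurableSet {q : ℝ × ℝ | q.2 < q.1} := measurableSet_lt (by fun_prop) (by fun_prop)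
  have hb := Integrable.bdd_mul (c := Real.exp (|lam| * T)) (f := {q : ℝ × ℝ | q.2 < q.1}.indicator
    (fun q => (Real.exp (-(lam * (q.1 - q.2))) : ℂ))) hprod
    (Measurable.aestronglyMeasurable (Measurable.indicator (by fun_prop) hmeas)) ?_
  · refine hb.congr (ae_of_all _ fun p => ?_)
    simp only [duhamelIntegrand]
    ring
  · rw [Measure.prod_restrict]
    refine (ae_restrict_iff' (measurableSet_Ioo.prod measurableSet_Ioo)).mpr (ae_of_all _ ?_)
    rintro ⟨τ, t⟩ ⟨hτ, ht⟩
    by_cases h : (τ, t) ∈ {q : ℝ × ℝ | q.2 < q.1}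
    · rw [indicator_of_mem h, Complex.norm_real, Real.norm_of_nonneg (Real.exp_pos _).le]
      refine Real.exp_le_exp.mpr ?_
      simp only [mem_ofPred_eq] at h
      have h1 : -(lam * (τ - t)) ≤ |lam| * (τ - t) := by
        nlinarith [neg_abs_le lam]
      exact h1.trans (mul_le_mul_of_nonneg_left (by linarith [hτ.2, ht.1]) (abs_nonneg _))
    · rw [indicator_of_notMem h, norm_zero]
      positivity

lemma integral_duhamelIntegrand (lam : ℝ) {T : ℝ} (F : ℝ → ℂ) {τ : ℝ} (hτ : τ ∈ Ioo 0 T) :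
    ∫ t in Ioo 0 T, duhamelIntegrand lam F (τ, t) = duhamel lam F τ := by
  have : ∀ t, duhamelIntegrand lam F (τ, t) =
      (Iio τ).indicator (fun t => (Real.exp (-(lam * (τ - t))) : ℂ) * F t) t := fun t => by
    by_cases h : t < τ
    · rw [duhamelIntegrand, indicator_of_mem (by exact h), indicator_of_mem (by exact h)]
    · rw [duhamelIntegrand, indicator_of_notMem (by exact h), indicator_of_notMem (by exact h),
        zero_mul]
  simp only [this]
  rw [setIntegral_indicator measurableSet_Iio, duhamel]
  congr 2
  ext t
  simp only [mem_inter_iff, mem_Ioo, mem_Iio]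
  constructor
  · rintro ⟨⟨h1, h2⟩, h3⟩; exact ⟨h1, h3⟩
  · rintro ⟨h1, h3⟩; exact ⟨⟨h1, h3.trans hτ.2⟩, h3⟩

lemma integrableOn_duhamel (lam : ℝ) {T : ℝ} {F : ℝ → ℂ} (hF : IntegrableOn F (Ioo 0 T)) :
    IntegrableOn (duhamel lam F) (Ioo 0 T) := by
  have := (integrable_duhamelIntegrand lam (ψ := fun _ => 1) continuous_const hF).integral_prod_left
  refine this.congr ((ae_restrict_iff' measurableSet_Ioo).mpr (ae_of_all _ fun τ hτ => ?_))
  simp only [Complex.ofReal_one, one_mul]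
  exact integral_duhamelIntegrand lam F hτ

/-- Fubini on the triangle `t < τ`: solving backward is the adjoint of solving forward. -/
lemma integral_mul_duhamel (lam : ℝ) {T : ℝ} {F : ℝ → ℂ} {ψ : ℝ → ℝ}
    (hψ : Continuous ψ) (hF : IntegrableOn F (Ioo 0 T)) :
    ∫ τ in Ioo 0 T, (ψ τ : ℂ) * duhamel lam F τ =
      ∫ t in Ioo 0 T, (backwardSol lam T ψ t : ℂ) * F t := by
  have h1 : ∫ τ in Ioo 0 T, (ψ τ : ℂ) * duhamel lam F τ =
      ∫ τ in Ioo 0 T, ∫ t in Ioo 0 T, (ψ τ : ℂ) * duhamelIntegrand lam F (τ, t) := by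
    refine setIntegral_congr_fun measurableSet_Ioo fun τ hτ => ?_
    rw [integral_const_mul, integral_duhamelIntegrand lam F hτ]
  rw [h1, integral_integral_swap (integrable_duhamelIntegrand lam hψ hF)]
  refine setIntegral_congr_fun measurableSet_Ioo fun t ht => ?_
  have h2 : ∀ τ, (ψ τ : ℂ) * duhamelIntegrand lam F (τ, t) =
      (Ioi t).indicator (fun τ => ((Real.exp (lam * t) * (Real.exp (-(lam * τ)) * ψ τ) : ℝ) : ℂ)) τ
        * F t := fun τ => by
    by_cases h : t < τ
    · rw [duhamelIntegrand, indicator_of_mem (by exact h), indicator_of_mem (by exact h),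
        ← mul_assoc (Real.exp (lam * t)), ← Real.exp_add,
        show lam * t + -(lam * τ) = -(lam * (τ - t)) by ring]
      push_cast
      ring
    · rw [duhamelIntegrand, indicator_of_notMem (by exact h), indicator_of_notMem (by exact h)]
      ring
  simp only [h2]
  rw [integral_mul_const, setIntegral_indicator measurableSet_Ioi, integral_complex_ofReal,
    integral_const_mul, backwardSol, intervalIntegral.integral_of_le ht.2.le,
    integral_Ioc_eq_integral_Ioo]
  congr 5
  ext τ
  simp only [mem_inter_iff, mem_Ioo, mem_Ioi]
  constructor
  · rintro ⟨⟨h1, h2⟩, h3⟩; exact ⟨h3, h2⟩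
  · rintro ⟨h1, h3⟩; exact ⟨⟨ht.1.trans h1, h3⟩, h1⟩

/-- A weak solution of `a' + λ a = F`, `a(0) = 0` on `(0, T)` is given by Duhamel's formula. -/
lemma ae_eq_duhamel_of_weak (lam : ℝ) {T : ℝ} {a F : ℝ → ℂ}
    (ha : IntegrableOn a (Ioo 0 T)) (hF : IntegrableOn F (Ioo 0 T))
    (h : ∀ η : ℝ → ℝ, ContDiff ℝ ∞ η → HasCompactSupport η → tsupport η ⊆ Iio T →
      ∫ t in Ioo 0 T, ((-deriv η t + lam * η t : ℝ) : ℂ) * a t =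
        ∫ t in Ioo 0 T, (η t : ℂ) * F t) :
    ∀ᵐ t ∂volume.restrict (Ioo 0 T), a t = duhamel lam F t := by
  have hdu := integrableOn_duhamel lam hF
  -- It suffices to test the difference against `ψ ∈ C_c^∞(0, T)`. By duality this amounts to
  -- testing the equation for `a` with the backward solution for `ψ`.
  have key : ∀ᵐ t, t ∈ Ioo 0 T → a t - duhamel lam F t = 0 := by
    refine isOpen_Ioo.ae_eq_zero_of_integral_contDiff_smul_eq_zero
      (f := fun t => a t - duhamel lam F t) (ha.sub hdu).locallyIntegrableOn ?_
    intro ψ hψ hψc hψs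
    have hzero : ∀ t, t ∉ Ioo 0 T → ψ t = 0 := fun t ht =>
      image_eq_zero_of_notMem_tsupport fun h' => ht (hψs h')
    rw [← setIntegral_eq_integral_of_forall_compl_eq_zero (s := Ioo 0 T) fun t ht => by
      rw [hzero t ht, zero_smul]]
    have hbd : ∃ C, ∀ t, ‖(ψ t : ℂ)‖ ≤ C := by
      obtain ⟨C, hC⟩ := hψc.exists_bound_of_continuous hψ.continuous
      exact ⟨C, fun t => by rw [Complex.norm_real]; exact hC t⟩
    obtain ⟨C, hC⟩ := hbd
    have hm : AEStronglyMeasurable (fun t => (ψ t : ℂ)) (volume.restrict (Ioo 0 T)) :=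
      (Complex.continuous_ofReal.comp hψ.continuous).aestronglyMeasurable
    simp only [Complex.real_smul, mul_sub]
    rw [integral_sub (ha.bdd_mul hm (ae_of_all _ hC)) (hdu.bdd_mul hm (ae_of_all _ hC)),
      integral_mul_duhamel lam hψ.continuous hF, sub_eq_zero]
    -- A point `b < T` beyond which `ψ` vanishes keeps the support of the backward solution away
    -- from `T`.
    obtain ⟨b, hbT, hb⟩ : ∃ b < T, ∀ τ, b < τ → ψ τ = 0 := by
      rcases (tsupport ψ).eq_empty_or_nonempty with he | hne
      · exact ⟨T - 1, by linarith, fun τ _ => image_eq_zero_of_notMem_tsupport (by simp [he])⟩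
      · obtain ⟨b, hbm, hb⟩ := hψc.isCompact.exists_isGreatest hne
        exact ⟨b, (hψs hbm).2, fun τ hτ => image_eq_zero_of_notMem_tsupport
          fun h' => absurd (hb h') (not_le.mpr hτ)⟩
    -- The backward solution need not vanish for `t ≤ 0`. The cutoff equals `0` for `t ≤ -1` and `1`
    -- for `t ≥ 0`, so it produces compact support without changing anything on `(0, T)`.
    set η : ℝ → ℝ := fun t => Real.smoothTransition (t + 1) * backwardSol lam T ψ t with hη
    have hηc : ContDiff ℝ ∞ η :=
      (Real.smoothTransition.contDiff.comp (contDiff_id.add contDiff_const)).mul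
        (contDiff_backwardSol lam T hψ)
    have hback : ∀ t, b ≤ t → backwardSol lam T ψ t = 0 := fun t ht => by
      rw [backwardSol, intervalIntegral.integral_zero_ae, mul_zero]
      refine ae_of_all _ fun τ hτ => ?_
      rw [hb τ, mul_zero]
      rcases le_total t T with h' | h'
      · rw [uIoc_of_le h'] at hτ; exact ht.trans_lt hτ.1
      · rw [uIoc_of_ge h'] at hτ; exact hbT.trans hτ.1
    have hsupp : tsupport η ⊆ Icc (-1) b := by
      refine closure_minimal (fun t ht => ?_) isClosed_Icc
      rw [Function.mem_support] at ht
      refine ⟨?_, ?_⟩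
      · by_contra! h'
        exact ht (by rw [hη]; simp only; rw [Real.smoothTransition.zero_of_nonpos (by linarith),
          zero_mul])
      · by_contra! h'
        exact ht (by rw [hη]; simp only; rw [hback t h'.le, mul_zero])
    have hηs : HasCompactSupport η := isCompact_Icc.of_isClosed_subset (isClosed_tsupport _) hsupp
    have := h η hηc hηs (hsupp.trans fun t ht => ht.2.trans_lt hbT)
    have hηeq : ∀ t, 0 < t → η =ᶠ[𝓝 t] backwardSol lam T ψ := fun t ht => by
      filter_upwards [lt_mem_nhds ht] with τ hτ
      rw [hη]
      simp only
      rw [Real.smoothTransition.one_of_one_le (by linarith), one_mul]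
    have e1 : ∀ t ∈ Ioo 0 T, ((-deriv η t + lam * η t : ℝ) : ℂ) * a t = (ψ t : ℂ) * a t := by
      intro t ht
      rw [(hηeq t ht.1).deriv_eq, (hηeq t ht.1).eq_of_nhds,
        (hasDerivAt_backwardSol lam T hψ.continuous t).deriv]
      congr 2
      ring
    have e2 : ∀ t ∈ Ioo 0 T, (η t : ℂ) * F t = (backwardSol lam T ψ t : ℂ) * F t := by
      intro t ht
      rw [(hηeq t ht.1).eq_of_nhds]
    rwa [setIntegral_congr_fun measurableSet_Ioo e1,
      setIntegral_congr_fun measurableSet_Ioo e2] at this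
  rw [ae_restrict_iff' measurableSet_Ioo]
  filter_upwards [key] with t ht h'
  exact sub_eq_zero.mp (ht h')

end ActiveScalar

end

noncomputable section

namespace ActiveScalar

open UnitAddTorus ComplexConjugate

/-! ### Fourier modes on the torus -/

lemma torusCoeff_eq (g : Torus → ℝ) (k : Freq) :
    torusCoeff g k = ∫ x, mFourier (-k) x * (g x : ℂ) ∂torusMeasure := rfl

lemma norm_mFourier_apply (k : Freq) (x : Torus) : ‖mFourier k x‖ = 1 := by
  simp [mFourier, fourier_apply, Circle.norm_coe]

lemma mFourier_toTorus (k : Freq) (y : Fin 2 → ℝ) :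
    mFourier k (toTorus y) = ∏ i, Complex.exp (2 * Real.pi * Complex.I * k i * y i) := by
  simp [mFourier, toTorus]

lemma contDiff_mFourier_toTorus (k : Freq) :
    ContDiff ℝ ∞ fun y : Fin 2 → ℝ => mFourier k (toTorus y) := by
  simp only [mFourier_toTorus]
  refine contDiff_prod fun i _ => ContDiff.cexp ?_
  refine contDiff_const.mul ?_
  exact Complex.ofRealCLM.contDiff.comp (contDiff_apply ℝ ℝ i)

lemma mFourier_add_apply (k : Freq) (x y : Torus) :
    mFourier k (x + y) = mFourier k x * mFourier k y := by
  simp [mFourier, fourier_apply, AddCircle.toCircle_add, smul_add]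
  ring

lemma mFourier_single_coe (k : Freq) (j : Fin 2) (h : ℝ) :
    mFourier k (Pi.single j (h : UnitAddCircle)) =
      Complex.exp (2 * Real.pi * Complex.I * k j * h) := by
  have : (Pi.single j (h : UnitAddCircle) : Torus) = toTorus (Pi.single j h) := by
    ext i
    rcases eq_or_ne i j with rfl | hij
    · simp [toTorus]
    · simp [toTorus, hij]
  rw [this, mFourier_toTorus, Finset.prod_eq_single j]
  · simp
  · intro i _ hij; simp [hij]
  · simp

lemma integral_mFourier (k : Freq) : ∫ x, mFourier k x ∂torusMeasure = if k = 0 then 1 else 0 := by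
  have := orthonormal_iff_ite.mp (orthonormal_mFourier (d := Fin 2)) 0 k
  simp only [ContinuousMap.inner_toLp, mFourier_zero, ContinuousMap.one_apply, map_one, mul_one,
    eq_comm (a := (0 : Freq))] at this
  exact this

/-- The real trigonometric polynomial `Re (c e^{2πi k·x})`. -/
def realMode (c : ℂ) (k : Freq) (x : Torus) : ℝ := (c * mFourier k x).re

lemma contDiff_realMode (c : ℂ) (k : Freq) :
    ContDiff ℝ ∞ fun y : Fin 2 → ℝ => realMode c k (toTorus y) :=
  Complex.reCLM.contDiff.comp (contDiff_const.mul (contDiff_mFourier_toTorus k))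

lemma partialDeriv_realMode (j : Fin 2) (c : ℂ) (k : Freq) (x : Torus) :
    partialDeriv j (realMode c k) x = realMode (2 * Real.pi * Complex.I * k j * c) k x := by
  have h1 : HasDerivAt (fun h : ℝ => c * mFourier k (x + Pi.single j (h : UnitAddCircle)))
      (2 * Real.pi * Complex.I * k j * c * mFourier k x) 0 := by
    simp only [mFourier_add_apply, mFourier_single_coe]
    have h2 : HasDerivAt (fun h : ℝ => Complex.exp (2 * Real.pi * Complex.I * k j * h))
        (Complex.exp (2 * Real.pi * Complex.I * k j * (0 : ℝ)) *
          (2 * Real.pi * Complex.I * k j * 1)) 0 :=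
      ((HasDerivAt.ofReal_comp (hasDerivAt_id (0 : ℝ))).const_mul _).cexp
    refine ((h2.const_mul (mFourier k x)).const_mul c).congr_deriv ?_
    simp
    ring
  exact (Complex.reCLM.hasFDerivAt.comp_hasDerivAt _ h1).deriv

lemma integrable_mFourier_mul {g : Torus → ℝ} (hg : Integrable g torusMeasure) (k : Freq) :
    Integrable (fun x => mFourier k x * (g x : ℂ)) torusMeasure :=
  hg.ofReal.bdd_mul (c := 1) (by fun_prop)
    (ae_of_all _ fun x => (norm_mFourier_apply k x).le)

/-- Test functions are real, but the free amplitude recovers the whole complex coefficient: `c = 1`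
gives the real part and `c = -i` the imaginary part. -/
lemma integral_mul_realMode {g : Torus → ℝ} (hg : Integrable g torusMeasure) (c : ℂ) (k : Freq) :
    ∫ x, g x * realMode c (-k) x ∂torusMeasure = (c * torusCoeff g k).re := by
  rw [torusCoeff_eq, ← integral_const_mul]
  have := integral_re ((integrable_mFourier_mul hg (-k)).const_mul c)
  simp only [RCLike.re_to_complex] at this
  rw [← this]
  refine integral_congr_ae (ae_of_all _ fun x => ?_)
  simp only [realMode]
  rw [← mul_assoc, Complex.re_mul_ofReal, mul_comm]

/-- From `Re z = (z + z̄)/2`. For `k = 0` both terms are present and add up to `Re c`. -/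
lemma torusCoeff_realMode (c : ℂ) (k m : Freq) :
    torusCoeff (realMode c k) m = (if m = k then c / 2 else 0) + if m = -k then conj c / 2 else 0 := by
  have h : ∀ x, mFourier (-m) x * (realMode c k x : ℂ) =
      c / 2 * mFourier (-m + k) x + conj c / 2 * mFourier (-m + -k) x := fun x => by
    rw [realMode, Complex.re_eq_add_conj, map_mul, mFourier_add, mFourier_add, mFourier_neg (n := k)]
    ring
  have hi : ∀ n : Freq, Integrable (fun x => mFourier n x) torusMeasure := fun n =>
    (mFourier n).continuous.integrable_of_hasCompactSupport (HasCompactSupport.of_compactSpace _)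
  rw [torusCoeff_eq]
  simp only [h]
  rw [integral_add ((hi _).const_mul _) ((hi _).const_mul _), integral_const_mul,
    integral_const_mul, integral_mFourier, integral_mFourier]
  have e1 : -m + k = 0 ↔ m = k := by rw [neg_add_eq_zero]
  have e2 : -m + -k = 0 ↔ m = -k := by rw [neg_add_eq_zero]
  simp only [e1, e2, mul_ite, mul_one, mul_zero]

lemma freqNorm_neg (k : Freq) : freqNorm (-k) = freqNorm k := by simp [freqNorm]

lemma fracLaplacian_realMode (α : ℝ) (c : ℂ) (k : Freq) (x : Torus) :
    fracLaplacian α (realMode c k) x = heatRate α k * realMode c k x := by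
  have h : HasSum (fun m : Freq => (((2 * Real.pi * freqNorm m) ^ (2 * α) : ℝ) : ℂ) *
      torusCoeff (realMode c k) m * mFourier m x)
      ((heatRate α k : ℂ) * (c / 2) * mFourier k x +
        (heatRate α k : ℂ) * (conj c / 2) * mFourier (-k) x) := by
    refine ((hasSum_ite_eq k ((heatRate α k : ℂ) * (c / 2) * mFourier k x)).add
      (hasSum_ite_eq (-k) ((heatRate α k : ℂ) * (conj c / 2) * mFourier (-k) x))).congr_fun
        fun m => ?_
    rw [torusCoeff_realMode, mul_add, add_mul]
    congr 1
    · split_ifs with hm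
      · rw [hm, heatRate]
      · simp
    · split_ifs with hm
      · rw [hm, heatRate, freqNorm_neg]
      · simp
  rw [fracLaplacian, h.tsum_eq, realMode, mFourier_neg]
  have : (heatRate α k : ℂ) * (c / 2) * mFourier k x +
      (heatRate α k : ℂ) * (conj c / 2) * conj (mFourier k x) =
      ((heatRate α k * (c * mFourier k x).re : ℝ) : ℂ) := by
    rw [Complex.ofReal_mul, Complex.re_eq_add_conj, map_mul]
    ring
  rw [this, Complex.ofReal_re]

/-- The real factor is absorbed into the amplitude of the mode, so no linearity of the defining
series has to be proved. -/
lemma fracLaplacian_const_mul (α : ℝ) (r : ℝ) (c : ℂ) (k : Freq) (x : Torus) :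
    fracLaplacian α (fun y => r * realMode c k y) x = heatRate α k * (r * realMode c k x) := by
  have : (fun y => r * realMode c k y) = realMode (r * c) k := by
    ext y
    rw [realMode, realMode, mul_assoc, Complex.re_ofReal_mul]
  rw [this, fracLaplacian_realMode, realMode, realMode, mul_assoc, Complex.re_ofReal_mul]

lemma isTestFunction_mul_realMode {I : Set ℝ} {η : ℝ → ℝ} (hη : ContDiff ℝ ∞ η)
    (hc : HasCompactSupport η) (hs : tsupport η ⊆ I) (c : ℂ) (k : Freq) :
    IsTestFunction I fun t x => η t * realMode c k x := by
  have hsub : tsupport (Function.uncurry fun t x => η t * realMode c k x) ⊆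
      tsupport η ×ˢ (univ : Set Torus) := by
    refine closure_minimal (fun p hp => ⟨?_, trivial⟩) ((isClosed_tsupport η).prod isClosed_univ)
    refine subset_tsupport η fun h => hp ?_
    simp [Function.uncurry, h]
  refine ⟨?_, ?_, hsub.trans (prod_mono hs subset_rfl)⟩
  · exact (hη.comp contDiff_fst).mul ((contDiff_realMode c k).comp contDiff_snd)
  · exact (hc.isCompact.prod isCompact_univ).of_isClosed_subset (isClosed_tsupport _) hsub

/-! ### The weak formulation on the Fourier side -/

lemma integrable_L2Torus (g : L2Torus) : Integrable g torusMeasure :=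
  (Lp.memLp g).integrable (by norm_num)

lemma solvesWeakly_mode {α T : ℝ} {F : ℝ → Torus → ℝ} {v : ℝ → L2Torus}
    (h : SolvesWeakly α T F v)
    (hF : ∀ᵐ t ∂volume.restrict (Ioo 0 T), Integrable (F t) torusMeasure)
    {η : ℝ → ℝ} (hη : ContDiff ℝ ∞ η) (hc : HasCompactSupport η) (hs : tsupport η ⊆ Iio T)
    (c : ℂ) (k : Freq) :
    ∫ t in Ioo 0 T, (-deriv η t + heatRate α k * η t) * (c * torusCoeff (v t) k).re =
      ∫ t in Ioo 0 T, η t * (c * torusCoeff (F t) k).re := by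
  have key := h _ (isTestFunction_mul_realMode hη hc hs c (-k))
  have hl : ∀ t, ∫ x, (-(v t x * deriv (fun τ => η τ * realMode c (-k) x) t) +
      v t x * fracLaplacian α (fun y => η t * realMode c (-k) y) x) ∂torusMeasure =
      (-deriv η t + heatRate α k * η t) * (c * torusCoeff (v t) k).re := fun t => by
    rw [← integral_mul_realMode (integrable_L2Torus (v t)), ← integral_const_mul]
    refine integral_congr_ae (ae_of_all _ fun x => ?_)
    simp only
    rw [fracLaplacian_const_mul, deriv_mul_const ((hη.differentiable (by simp)) t), heatRate,
      heatRate, freqNorm_neg]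
    ring
  simp only [hl] at key
  rw [key]
  refine integral_congr_ae ?_
  filter_upwards [hF] with t ht
  rw [← integral_mul_realMode ht, ← integral_const_mul]
  refine integral_congr_ae (ae_of_all _ fun x => ?_)
  simp only
  ring

/-- The Fourier coefficients of a weak solution are given by Duhamel's formula. -/
lemma torusCoeff_eq_duhamel {α T : ℝ} {F : ℝ → Torus → ℝ} {v : ℝ → L2Torus}
    (h : SolvesWeakly α T F v)
    (hF : ∀ᵐ t ∂volume.restrict (Ioo 0 T), Integrable (F t) torusMeasure) (k : Freq)
    (hvk : IntegrableOn (fun t => torusCoeff (v t) k) (Ioo 0 T))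
    (hFk : IntegrableOn (fun t => torusCoeff (F t) k) (Ioo 0 T)) :
    ∀ᵐ t ∂volume.restrict (Ioo 0 T),
      torusCoeff (v t) k = duhamel (heatRate α k) (fun τ => torusCoeff (F τ) k) t := by
  refine ae_eq_duhamel_of_weak _ hvk hFk fun η hη hc hs => ?_
  have hm := fun c => solvesWeakly_mode h hF hη hc hs c k
  obtain ⟨C₁, hC₁⟩ := hc.exists_bound_of_continuous hη.continuous
  have hdc : Continuous (deriv η) := hη.continuous_deriv (by simp)
  obtain ⟨C₂, hC₂⟩ := hc.deriv.exists_bound_of_continuous hdc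
  have hi1 : Integrable (fun t => ((-deriv η t + heatRate α k * η t : ℝ) : ℂ) * torusCoeff (v t) k)
      (volume.restrict (Ioo 0 T)) := by
    refine Integrable.bdd_mul (c := C₂ + |heatRate α k| * C₁) hvk ?_ (ae_of_all _ fun t => ?_)
    · exact (Complex.continuous_ofReal.comp
        (hdc.neg.add (continuous_const.mul hη.continuous))).aestronglyMeasurable
    · rw [Complex.norm_real]
      refine (norm_add_le _ _).trans (add_le_add ?_ ?_)
      · rw [norm_neg]; exact hC₂ t
      · rw [norm_mul, Real.norm_eq_abs (heatRate α k)]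
        exact mul_le_mul_of_nonneg_left (hC₁ t) (abs_nonneg _)
  have hi2 : Integrable (fun t => (η t : ℂ) * torusCoeff (F t) k)
      (volume.restrict (Ioo 0 T)) := by
    refine Integrable.bdd_mul (c := C₁) hFk ?_ (ae_of_all _ fun t => ?_)
    · exact (Complex.continuous_ofReal.comp hη.continuous).aestronglyMeasurable
    · rw [Complex.norm_real]; exact hC₁ t
  have hre : ∀ c : ℂ, (c * ∫ t in Ioo 0 T, ((-deriv η t + heatRate α k * η t : ℝ) : ℂ) *
      torusCoeff (v t) k).re = (c * ∫ t in Ioo 0 T, (η t : ℂ) * torusCoeff (F t) k).re := by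
    intro c
    have e1 := integral_re (hi1.const_mul c)
    have e2 := integral_re (hi2.const_mul c)
    simp only [RCLike.re_to_complex] at e1 e2
    rw [← integral_const_mul, ← integral_const_mul, ← e1, ← e2]
    convert hm c using 1
    · refine integral_congr_ae (ae_of_all _ fun t => ?_)
      simp only
      rw [mul_left_comm, Complex.re_ofReal_mul]
    · refine integral_congr_ae (ae_of_all _ fun t => ?_)
      simp only
      rw [mul_left_comm, Complex.re_ofReal_mul]
  refine Complex.ext ?_ ?_
  · simpa using hre 1
  · simpa using hre (-Complex.I)

end ActiveScalar

end

noncomputable section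

namespace ActiveScalar

open UnitAddTorus ComplexConjugate

/-! ### Uniqueness of Fourier coefficients -/

/-- The positive and negative parts of `g` are densities of finite measures that agree on bounded
continuous functions, hence are equal. Since at each point one of the two parts is zero, both vanish
a.e. -/
lemma ae_eq_zero_of_forall_integral_continuous {g : Torus → ℝ} (hg : Integrable g torusMeasure)
    (h : ∀ φ : Torus → ℝ, Continuous φ → ∫ x, g x * φ x ∂torusMeasure = 0) :
    g =ᵐ[torusMeasure] 0 := by
  have hm1 : AEMeasurable (fun x => ENNReal.ofReal (g x)) torusMeasure :=
    hg.aemeasurable.ennreal_ofReal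
  have hm2 : AEMeasurable (fun x => ENNReal.ofReal (-g x)) torusMeasure :=
    hg.neg.aemeasurable.ennreal_ofReal
  have hf1 : ∫⁻ x, ENNReal.ofReal (g x) ∂torusMeasure ≠ ⊤ := hg.lintegral_lt_top.ne
  have hf2 : ∫⁻ x, ENNReal.ofReal (-g x) ∂torusMeasure ≠ ⊤ := hg.neg.lintegral_lt_top.ne
  have : IsFiniteMeasure (torusMeasure.withDensity fun x => ENNReal.ofReal (g x)) :=
    isFiniteMeasure_withDensity hf1
  have : IsFiniteMeasure (torusMeasure.withDensity fun x => ENNReal.ofReal (-g x)) :=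
    isFiniteMeasure_withDensity hf2
  have heq : torusMeasure.withDensity (fun x => ENNReal.ofReal (g x)) =
      torusMeasure.withDensity fun x => ENNReal.ofReal (-g x) := by
    refine ext_of_forall_integral_eq_of_IsFiniteMeasure fun φ => ?_
    rw [integral_withDensity_eq_integral_toReal_smul₀ hm1 (ae_of_all _ fun _ =>
      ENNReal.ofReal_lt_top), integral_withDensity_eq_integral_toReal_smul₀ hm2
      (ae_of_all _ fun _ => ENNReal.ofReal_lt_top), ← sub_eq_zero]
    have hb : ∀ q : Torus → ℝ, Integrable q torusMeasure →
        Integrable (fun x => (ENNReal.ofReal (q x)).toReal • φ x) torusMeasure := by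
      intro q hq
      simp only [ENNReal.toReal_ofReal', smul_eq_mul]
      exact hq.pos_part.mul_bdd φ.continuous.aestronglyMeasurable
        (ae_of_all _ fun x => φ.norm_coe_le_norm x)
    rw [← integral_sub (hb g hg) (hb (fun x => -g x) hg.neg), ← h φ φ.continuous]
    refine integral_congr_ae (ae_of_all _ fun x => ?_)
    simp only [ENNReal.toReal_ofReal', smul_eq_mul]
    rw [← sub_mul, max_zero_sub_max_neg_zero_eq_self]
  rw [withDensity_eq_iff hm1 hm2 hf1] at heq
  filter_upwards [heq] with x hx
  rcases le_total (g x) 0 with h0 | h0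
  · rw [ENNReal.ofReal_of_nonpos h0, eq_comm, ENNReal.ofReal_eq_zero] at hx
    have h1 : 0 ≤ g x := by linarith
    exact le_antisymm h0 h1
  · rw [ENNReal.ofReal_of_nonpos (neg_nonpos.mpr h0), ENNReal.ofReal_eq_zero] at hx
    exact le_antisymm hx h0

/-- An integrable function on the torus with vanishing Fourier coefficients vanishes a.e. -/
lemma ae_eq_zero_of_mFourierCoeff {g : Torus → ℂ} (hg : Integrable g torusMeasure)
    (h : ∀ k, ∫ x, mFourier k x * g x ∂torusMeasure = 0) : g =ᵐ[torusMeasure] 0 := by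
  have hint : ∀ φ : C(Torus, ℂ), Integrable (fun x => φ x * g x) torusMeasure := fun φ =>
    hg.bdd_mul φ.continuous.aestronglyMeasurable (ae_of_all _ fun x => φ.norm_coe_le_norm x)
  -- The continuous functions annihilated by `g` form a subspace, closed in the sup norm because `g`
  -- is integrable. It contains all characters, whose span is dense, so it is everything.
  let V : Submodule ℂ C(Torus, ℂ) :=
    { carrier := {φ | ∫ x, φ x * g x ∂torusMeasure = 0}
      zero_mem' := by simp
      add_mem' := fun {a b} (ha : _ = _) (hb : _ = _) => by
        change ∫ x, (a x + b x) * g x ∂torusMeasure = 0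
        simp only [add_mul]
        rw [integral_add (hint a) (hint b), ha, hb, add_zero]
      smul_mem' := fun c a (ha : _ = _) => by
        change ∫ x, (c * a x) * g x ∂torusMeasure = 0
        simp only [mul_assoc]
        rw [integral_const_mul, ha, mul_zero] }
  have hclosed : IsClosed (V : Set C(Torus, ℂ)) := by
    have hc : Continuous fun φ : C(Torus, ℂ) => ∫ x, φ x * g x ∂torusMeasure := by
      refine LipschitzWith.continuous (K := (∫ x, ‖g x‖ ∂torusMeasure).toNNReal)
        (LipschitzWith.of_dist_le_mul fun φ ψ => ?_)
      rw [dist_eq_norm, dist_eq_norm, ← integral_sub (hint φ) (hint ψ), Real.coe_toNNReal _ (by positivity), mul_comm,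
        ← integral_const_mul]
      refine norm_integral_le_of_norm_le (hg.norm.const_mul _) (ae_of_all _ fun x => ?_)
      rw [← sub_mul, norm_mul]
      exact mul_le_mul_of_nonneg_right ((φ - ψ).norm_coe_le_norm x) (norm_nonneg _)
    exact isClosed_eq hc continuous_const
  have htop : V = ⊤ := by
    rw [eq_top_iff, ← span_mFourier_closure_eq_top]
    refine Submodule.topologicalClosure_minimal _ (Submodule.span_le.mpr ?_) hclosed
    rintro _ ⟨k, rfl⟩
    exact h k
  have hall : ∀ φ : Torus → ℝ, Continuous φ → ∫ x, (φ x : ℂ) * g x ∂torusMeasure = 0 := by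
    intro φ hφ
    have : (⟨fun x => (φ x : ℂ), by fun_prop⟩ : C(Torus, ℂ)) ∈ V := htop ▸ Submodule.mem_top
    exact this
  have hre : (fun x => (g x).re) =ᵐ[torusMeasure] 0 := by
    refine ae_eq_zero_of_forall_integral_continuous hg.re fun φ hφ => ?_
    have h1 := integral_re (hint ⟨fun x => (φ x : ℂ), by fun_prop⟩)
    simp only [RCLike.re_to_complex, ContinuousMap.coe_mk, Complex.re_ofReal_mul] at h1
    rw [hall φ hφ, Complex.zero_re] at h1
    rw [← h1]
    exact integral_congr_ae (ae_of_all _ fun x => mul_comm _ _)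
  have him : (fun x => (g x).im) =ᵐ[torusMeasure] 0 := by
    refine ae_eq_zero_of_forall_integral_continuous hg.im fun φ hφ => ?_
    have h1 := integral_im (hint ⟨fun x => (φ x : ℂ), by fun_prop⟩)
    simp only [RCLike.im_to_complex, ContinuousMap.coe_mk, Complex.im_ofReal_mul] at h1
    rw [hall φ hφ, Complex.zero_im] at h1
    rw [← h1]
    exact integral_congr_ae (ae_of_all _ fun x => mul_comm _ _)
  filter_upwards [hre, him] with x h1 h2
  exact Complex.ext h1 h2

/-- An integrable function with absolutely summable Fourier coefficients is a.e. the sum of its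
Fourier series. -/
lemma ae_eq_tsum_of_summable {u : Torus → ℝ} (hu : Integrable u torusMeasure)
    (hs : Summable fun k => ‖torusCoeff u k‖) :
    ∀ᵐ x ∂torusMeasure, (u x : ℂ) = ∑' k, torusCoeff u k * mFourier k x := by
  have hn : ∀ (k : Freq) (x : Torus), ‖torusCoeff u k * mFourier k x‖ = ‖torusCoeff u k‖ :=
    fun k x => by rw [norm_mul, norm_mFourier_apply, mul_one]
  have hcont : Continuous fun x => ∑' k, torusCoeff u k * mFourier k x :=
    continuous_tsum (fun k => by fun_prop) hs fun k x => (hn k x).le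
  have hSi : Integrable (fun x => ∑' k, torusCoeff u k * mFourier k x) torusMeasure :=
    hcont.integrable_of_hasCompactSupport (HasCompactSupport.of_compactSpace _)
  -- The series converges uniformly, so orthogonality applies termwise and the difference has zero
  -- coefficients.
  have hz : (fun x => (u x : ℂ) - ∑' k, torusCoeff u k * mFourier k x) =ᵐ[torusMeasure] 0 := by
    refine ae_eq_zero_of_mFourierCoeff (hu.ofReal.sub hSi) fun m => ?_
    have hc1 : AEStronglyMeasurable (fun x => mFourier m x) torusMeasure :=
      (mFourier m).continuous.aestronglyMeasurable
    have hb1 : ∀ᵐ x ∂torusMeasure, ‖mFourier m x‖ ≤ 1 :=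
      ae_of_all _ fun x => (norm_mFourier_apply m x).le
    have hi2 : Integrable (fun x => mFourier m x * ∑' k, torusCoeff u k * mFourier k x)
      torusMeasure := hSi.bdd_mul hc1 hb1
    simp only [mul_sub]
    rw [integral_sub (integrable_mFourier_mul hu m) hi2]
    have hcoe : ∫ x, mFourier m x * (u x : ℂ) ∂torusMeasure = torusCoeff u (-m) := by
      rw [torusCoeff_eq, neg_neg]
    have hterm : ∀ k : Freq, ∫ x, mFourier m x * (torusCoeff u k * mFourier k x) ∂torusMeasure =
        if k = -m then torusCoeff u (-m) else 0 := fun k => by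
      simp only [mul_left_comm _ (torusCoeff u k), ← mFourier_add]
      rw [integral_const_mul, integral_mFourier]
      have : m + k = 0 ↔ k = -m := by rw [add_comm, add_eq_zero_iff_eq_neg]
      simp only [this]
      split_ifs with h
      · rw [h, mul_one]
      · rw [mul_zero]
    have hsum := hasSum_integral_of_summable_integral_norm (μ := torusMeasure)
      (F := fun (k : Freq) x => mFourier m x * (torusCoeff u k * mFourier k x))
      (fun k => Continuous.integrable_of_hasCompactSupport (by fun_prop)
        (HasCompactSupport.of_compactSpace _))
      (by simpa [norm_mul, norm_mFourier_apply] using hs)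
    simp only [hterm, tsum_mul_left] at hsum
    rw [hcoe, hsum.unique (hasSum_ite_eq (-m) _), sub_self]
  filter_upwards [hz] with x hx
  exact sub_eq_zero.mp hx

/-- The Fourier coefficients of a product are a convolution. -/
lemma hasSum_torusCoeff_mul {u G : Torus → ℝ} (hu : Integrable u torusMeasure)
    (hs : Summable fun k => ‖torusCoeff u k‖) (hG : Integrable G torusMeasure) :
    Integrable (fun x => u x * G x) torusMeasure ∧
      ∀ k, HasSum (fun l => torusCoeff u l * torusCoeff G (k - l))
        (torusCoeff (fun x => u x * G x) k) := by
  have hae := ae_eq_tsum_of_summable hu hs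
  have hn : ∀ (k : Freq) (x : Torus), ‖torusCoeff u k * mFourier k x‖ = ‖torusCoeff u k‖ :=
    fun k x => by rw [norm_mul, norm_mFourier_apply, mul_one]
  refine ⟨?_, fun k => ?_⟩
  -- Only `u` needs summable coefficients: it is then essentially bounded by their sum, and `G` may
  -- be merely integrable.
  · refine hG.bdd_mul (c := ∑' k, ‖torusCoeff u k‖) hu.aestronglyMeasurable ?_
    filter_upwards [hae] with x hx
    rw [← Complex.norm_real, hx]
    refine (norm_tsum_le_tsum_norm ?_).trans (le_of_eq ?_)
    · simpa only [hn] using hs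
    · simp only [hn]
  · have hterm : ∀ l : Freq, ∫ x, torusCoeff u l * (mFourier (-(k - l)) x * (G x : ℂ)) ∂torusMeasure
        = torusCoeff u l * torusCoeff G (k - l) := fun l => by
      rw [integral_const_mul, torusCoeff_eq G]
    have hsum := hasSum_integral_of_summable_integral_norm (μ := torusMeasure)
      (F := fun (l : Freq) x => torusCoeff u l * (mFourier (-(k - l)) x * (G x : ℂ)))
      (fun l => (integrable_mFourier_mul hG _).const_mul _)
      (by
        simp only [norm_mul, norm_mFourier_apply, one_mul]
        simp only [integral_const_mul]
        exact hs.mul_right _)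
    simp only [hterm] at hsum
    have hint : torusCoeff (fun x => u x * G x) k =
        ∫ x, ∑' l, torusCoeff u l * (mFourier (-(k - l)) x * (G x : ℂ)) ∂torusMeasure := ?_
    · rw [hint]; exact hsum
    rw [torusCoeff_eq]
    refine integral_congr_ae ?_
    filter_upwards [hae] with x hx
    rw [Complex.ofReal_mul, hx, ← mul_assoc, ← tsum_mul_left, ← tsum_mul_right]
    refine tsum_congr fun l => ?_
    rw [show -(k - l) = -k + l by abel, mFourier_add]
    ring

/-! ### The coefficients of the transport term -/

lemma torusCoeff_of_isWeakPartial {j : Fin 2} {g v : Torus → ℝ} (h : IsWeakPartial j g v)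
    (k : Freq) : torusCoeff v k = 2 * Real.pi * Complex.I * k j * torusCoeff g k := by
  obtain ⟨hg, hv, h⟩ := h
  have key : ∀ c : ℂ, (c * torusCoeff v k).re =
      (c * (2 * Real.pi * Complex.I * k j * torusCoeff g k)).re := fun c => by
    have := h (realMode c (-k)) (contDiff_realMode c (-k))
    simp only [partialDeriv_realMode] at this
    rw [integral_mul_realMode hg, integral_mul_realMode hv] at this
    rw [← neg_eq_iff_eq_neg.mpr this, ← Complex.neg_re]
    congr 1
    simp only [Pi.neg_apply, Int.cast_neg]
    ring
  refine Complex.ext ?_ ?_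
  · simpa using key 1
  · simpa using key (-Complex.I)

/-- Splitting the character at `x = y + (x - y)` makes its product with `K * g` a convolution of two
modulated functions, and the integral of a convolution is the product of the integrals. -/
lemma torusCoeff_kernelConv {K g : Torus → ℝ} (hK : Integrable K torusMeasure)
    (hg : Integrable g torusMeasure) (k : Freq) :
    torusCoeff (kernelConv K g) k = torusCoeff K k * torusCoeff g k := by
  have := integral_convolution (μ := torusMeasure) (ν := torusMeasure)
    (ContinuousLinearMap.mul ℝ ℂ) (integrable_mFourier_mul hg (-k))
    (integrable_mFourier_mul hK (-k))
  rw [torusCoeff_eq K, torusCoeff_eq g, mul_comm]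
  rw [ContinuousLinearMap.mul_apply'] at this
  rw [← this, torusCoeff_eq]
  refine integral_congr_ae (ae_of_all _ fun x => ?_)
  simp only [kernelConv, convolution, ContinuousLinearMap.mul_apply']
  rw [← integral_complex_ofReal, ← integral_const_mul]
  refine integral_congr_ae (ae_of_all _ fun y => ?_)
  simp only
  have : mFourier (-k) x = mFourier (-k) y * mFourier (-k) (x - y) := by
    rw [← mFourier_add_apply, add_sub_cancel]
  rw [this, Complex.ofReal_mul]
  ring

/-- The symbol of the bilinear transport term `ℛθ · ∇θ`. -/
def transportSymbol (K : Torus → ℝ) (k l : Freq) : ℂ :=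
  (2 * Real.pi * Complex.I) ^ 2 * torusCoeff K l *
    ((l 0 : ℂ) * (k - l) 1 - (l 1 : ℂ) * (k - l) 0)

lemma exists_norm_torusCoeff_mul_le {K : Torus → ℝ} (hK : IsAdmissibleKernel K) :
    ∃ C : ℝ, 0 < C ∧ ∀ (l : Freq) j, ‖torusCoeff K l‖ * |(l j : ℝ)| ≤ C := by
  obtain ⟨c, C, hc, hC, hb⟩ := hK.coeff_bounds
  refine ⟨C, hC, fun l j => ?_⟩
  rcases eq_or_ne l 0 with rfl | hl
  · simpa using hC.le
  · obtain ⟨him, hlo, hhi⟩ := hb l hl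
    have hpos : 0 < freqNorm l := by linarith [one_le_freqNorm hl]
    -- The lower bound on the coefficient serves to make it nonnegative, so that its modulus is its
    -- real part.
    have hre : ‖torusCoeff K l‖ = (torusCoeff K l).re := by
      have : torusCoeff K l = ((torusCoeff K l).re : ℂ) := Complex.ext rfl (by simp [him])
      rw [this, Complex.norm_real, Complex.ofReal_re, Real.norm_of_nonneg]
      exact le_trans (by positivity) hlo
    calc ‖torusCoeff K l‖ * |(l j : ℝ)| ≤ (C * (freqNorm l)⁻¹) * freqNorm l := by
          rw [hre]
          exact mul_le_mul hhi (abs_coord_le_freqNorm l j) (abs_nonneg _) (by positivity)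
      _ = C := by field_simp

lemma norm_intCast_complex (n : ℤ) : ‖(n : ℂ)‖ = |(n : ℝ)| := by
  rw [← Complex.ofReal_intCast, Complex.norm_real, Real.norm_eq_abs]

lemma norm_two_pi_I : ‖(2 * Real.pi * Complex.I : ℂ)‖ = 2 * Real.pi := by
  simp [abs_of_pos Real.pi_pos]

/-- The factor `l` from the velocity is compensated by the decay of `K̂(l)`, so only the derivative
on the frequency `k - l` costs anything. -/
lemma exists_transportSymbol_le {K : Torus → ℝ} (hK : IsAdmissibleKernel K) :
    ∃ c : ℝ≥0∞, c ≠ ⊤ ∧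
      ∀ k l, ‖transportSymbol K k l‖ₑ ≤ c * sobolevWeight (1 / 2) (k - l) := by
  obtain ⟨C, hC, hsym⟩ := exists_norm_torusCoeff_mul_le hK
  refine ⟨ENNReal.ofReal ((2 * Real.pi) ^ 2 * (2 * C)), ENNReal.ofReal_ne_top, fun k l => ?_⟩
  rw [sobolevWeight, ← ENNReal.ofReal_mul (by positivity), ← ofReal_norm]
  refine ENNReal.ofReal_le_ofReal ?_
  have hw : ∀ j, |((k - l) j : ℝ)| ≤ (1 + freqNorm (k - l) ^ 2) ^ (1 / 2 : ℝ) := fun j => by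
    rw [← Real.sqrt_eq_rpow]
    refine Real.abs_le_sqrt ?_
    nlinarith [abs_coord_le_freqNorm (k - l) j, sq_abs ((k - l) j : ℝ),
      abs_nonneg ((k - l) j : ℝ)]
  set w := (1 + freqNorm (k - l) ^ 2) ^ (1 / 2 : ℝ)
  rw [transportSymbol, norm_mul, norm_mul, norm_pow, norm_two_pi_I, mul_assoc, mul_assoc]
  refine mul_le_mul_of_nonneg_left ?_ (by positivity)
  calc ‖torusCoeff K l‖ * ‖(l 0 : ℂ) * (k - l) 1 - (l 1 : ℂ) * (k - l) 0‖
      ≤ ‖torusCoeff K l‖ * (|(l 0 : ℝ)| * |((k - l) 1 : ℝ)| + |(l 1 : ℝ)| * |((k - l) 0 : ℝ)|) := by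
        refine mul_le_mul_of_nonneg_left ((norm_sub_le _ _).trans ?_) (norm_nonneg _)
        rw [norm_mul, norm_mul, norm_intCast_complex, norm_intCast_complex, norm_intCast_complex,
          norm_intCast_complex]
    _ = (‖torusCoeff K l‖ * |(l 0 : ℝ)|) * |((k - l) 1 : ℝ)| +
        (‖torusCoeff K l‖ * |(l 1 : ℝ)|) * |((k - l) 0 : ℝ)| := by ring
    _ ≤ C * w + C * w := by
        gcongr
        · exact hsym l 0
        · exact hw 1
        · exact hsym l 1
        · exact hw 0
    _ = 2 * C * w := by ring

lemma torusCoeff_velocity {K g : Torus → ℝ} {u : Fin 2 → Torus → ℝ} (hK : IsAdmissibleKernel K)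
    (hg : Integrable g torusMeasure) (hu : IsVelocity K g u) (k : Freq) :
    torusCoeff (u 0) k = -(2 * Real.pi * Complex.I * k 1 * (torusCoeff K k * torusCoeff g k)) ∧
      torusCoeff (u 1) k = 2 * Real.pi * Complex.I * k 0 * (torusCoeff K k * torusCoeff g k) := by
  rw [← torusCoeff_kernelConv hK.integrable hg k]
  refine ⟨?_, torusCoeff_of_isWeakPartial hu.2 k⟩
  rw [← torusCoeff_of_isWeakPartial hu.1 k, torusCoeff_eq, torusCoeff_eq, ← integral_neg]
  refine integral_congr_ae (ae_of_all _ fun x => ?_)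
  simp

/-- The Fourier coefficients of the transport term `ℛθ · ∇θ`. -/
lemma torusCoeff_transport {K g : Torus → ℝ} {u G : Fin 2 → Torus → ℝ} (hK : IsAdmissibleKernel K)
    (hg : Integrable g torusMeasure) (hs : Summable fun k => ‖torusCoeff g k‖)
    (hu : IsVelocity K g u) (hG : ∀ j, IsWeakPartial j g (G j)) :
    Integrable (fun x => ∑ j, u j x * G j x) torusMeasure ∧
      ∀ k, HasSum (fun l => transportSymbol K k l * torusCoeff g l * torusCoeff g (k - l))
        (torusCoeff (fun x => ∑ j, u j x * G j x) k) := by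
  obtain ⟨C, hC, hsym⟩ := exists_norm_torusCoeff_mul_le hK
  have hu0 : Integrable (u 0) torusMeasure := by simpa using hu.1.2.1.neg
  -- The indices `j` and `i` differ in use: the rotated gradient puts `k 1` in component `0` and `k
  -- 0` in component `1`.
  have hus : ∀ j i : Fin 2, (∀ k, ‖torusCoeff (u j) k‖ =
      2 * Real.pi * (‖torusCoeff K k‖ * |(k i : ℝ)|) * ‖torusCoeff g k‖) →
      Summable fun k => ‖torusCoeff (u j) k‖ := by
    intro j i h
    refine Summable.of_nonneg_of_le (fun k => norm_nonneg _) (fun k => ?_)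
      (hs.mul_left (2 * Real.pi * C))
    rw [h k]
    gcongr
    exact hsym k i
  have h0 := hasSum_torusCoeff_mul hu0 (hus 0 1 fun k => by
    rw [(torusCoeff_velocity hK hg hu k).1, norm_neg, norm_mul, norm_mul, norm_two_pi_I,
      norm_intCast_complex, norm_mul]
    ring) (hG 0).2.1
  have h1 := hasSum_torusCoeff_mul hu.2.2.1 (hus 1 0 fun k => by
    rw [(torusCoeff_velocity hK hg hu k).2, norm_mul, norm_mul, norm_two_pi_I,
      norm_intCast_complex, norm_mul]
    ring) (hG 1).2.1
  simp only [Fin.sum_univ_two]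
  refine ⟨h0.1.add h1.1, fun k => ?_⟩
  have hadd : torusCoeff (fun x => u 0 x * G 0 x + u 1 x * G 1 x) k =
      torusCoeff (fun x => u 0 x * G 0 x) k + torusCoeff (fun x => u 1 x * G 1 x) k := by
    simp only [torusCoeff_eq, Complex.ofReal_add, mul_add]
    exact integral_add (integrable_mFourier_mul h0.1 _) (integrable_mFourier_mul h1.1 _)
  rw [hadd]
  refine ((h0.2 k).add (h1.2 k)).congr_fun fun l => ?_
  rw [(torusCoeff_velocity hK hg hu l).1, (torusCoeff_velocity hK hg hu l).2,
    torusCoeff_of_isWeakPartial (hG 0), torusCoeff_of_isWeakPartial (hG 1), transportSymbol]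
  ring

lemma summable_norm_of_sobolevSq {s : ℝ} (hs : 1 < s) {a : Freq → ℂ} (ha : sobolevSq s a < ⊤) :
    Summable fun k => ‖a k‖ := by
  rw [← tsum_enorm_ne_top_iff_summable_norm]
  intro h
  have := sq_tsum_le_sobolevSq s a
  rw [h] at this
  have h2 : (∑' k, sobolevWeight (-s) k) * sobolevSq s a < ⊤ :=
    ENNReal.mul_lt_top (tsum_sobolevWeight_lt_top hs) ha
  simp only [ne_eq, OfNat.ofNat_ne_zero, not_false_eq_true, ENNReal.top_pow, top_le_iff] at this
  exact absurd this h2.ne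

/-- The `k`-th Fourier coefficient is a continuous functional on `L²`. -/
lemma continuous_torusCoeff (k : Freq) : Continuous fun g : L2Torus => torusCoeff g k := by
  refine LipschitzWith.continuous (K := 1) (LipschitzWith.of_dist_le_mul fun g h => ?_)
  have hgh : MemLp (⇑g - ⇑h) 2 torusMeasure := (Lp.memLp g).sub (Lp.memLp h)
  have hgi : Integrable (⇑g - ⇑h) torusMeasure := hgh.integrable (by norm_num)
  rw [NNReal.coe_one, one_mul, Lp.dist_def, dist_eq_norm, torusCoeff_eq, torusCoeff_eq,
    ← integral_sub (integrable_mFourier_mul (integrable_L2Torus g) _)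
      (integrable_mFourier_mul (integrable_L2Torus h) _)]
  calc ‖∫ x, (mFourier (-k) x * (g x : ℂ) - mFourier (-k) x * (h x : ℂ)) ∂torusMeasure‖
      ≤ ∫ x, ‖(⇑g - ⇑h) x‖ ∂torusMeasure := by
        refine norm_integral_le_of_norm_le hgi.norm (ae_of_all _ fun x => ?_)
        rw [← mul_sub, norm_mul, norm_mFourier_apply, one_mul, ← Complex.ofReal_sub,
          Complex.norm_real, Pi.sub_apply]
    _ = (eLpNorm (⇑g - ⇑h) 1 torusMeasure).toReal := by
        rw [integral_norm_eq_lintegral_enorm hgi.1, eLpNorm_one_eq_lintegral_enorm]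
    _ ≤ _ := ENNReal.toReal_mono hgh.eLpNorm_ne_top
        (eLpNorm_le_eLpNorm_of_exponent_le (by norm_num) hgi.1)

end ActiveScalar

end

noncomputable section

namespace ActiveScalar

open UnitAddTorus ComplexConjugate

/-! ### Smooth sources -/

/-- Time-dependent functions on the torus, smooth in time and space. -/
def SmoothPath (f : ℝ → Torus → ℝ) : Prop :=
  ContDiff ℝ ∞ fun p : ℝ × (Fin 2 → ℝ) => f p.1 (toTorus p.2)

lemma isOpenQuotientMap_toTorus : IsOpenQuotientMap toTorus := by
  have h : IsOpenQuotientMap ((↑) : ℝ → UnitAddCircle) := QuotientAddGroup.isOpenQuotientMap_mk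
  exact IsOpenQuotientMap.piMap fun _ => h

/-- Smoothness is imposed on the cover `ℝ × ℝ²`; continuity descends along the open quotient map. -/
lemma SmoothPath.continuous {f : ℝ → Torus → ℝ} (hf : SmoothPath f) :
    Continuous (Function.uncurry f) := by
  have hq : IsOpenQuotientMap (Prod.map id toTorus : ℝ × (Fin 2 → ℝ) → ℝ × Torus) :=
    IsOpenQuotientMap.id.prodMap isOpenQuotientMap_toTorus
  exact hq.isQuotientMap.continuous_iff.mpr (ContDiff.continuous hf)

lemma SmoothPath.continuous_apply {f : ℝ → Torus → ℝ} (hf : SmoothPath f) (t : ℝ) :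
    Continuous (f t) := hf.continuous.comp (Continuous.prodMk_right t)

lemma SmoothPath.integrable {f : ℝ → Torus → ℝ} (hf : SmoothPath f) (t : ℝ) :
    Integrable (f t) torusMeasure :=
  (hf.continuous_apply t).integrable_of_hasCompactSupport (HasCompactSupport.of_compactSpace _)

lemma SmoothPath.continuous_torusCoeff {f : ℝ → Torus → ℝ} (hf : SmoothPath f) (k : Freq) :
    Continuous fun t => torusCoeff (f t) k := by
  simp only [torusCoeff_eq]
  have hc : Continuous (Function.uncurry fun t (x : Torus) => mFourier (-k) x * (f t x : ℂ)) :=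
    ((mFourier (-k)).continuous.comp continuous_snd).mul
      (Complex.continuous_ofReal.comp hf.continuous)
  simpa only [Measure.restrict_univ] using
    continuous_parametric_integral_of_continuous (μ := torusMeasure) hc isCompact_univ

lemma SmoothPath.sub {f g : ℝ → Torus → ℝ} (hf : SmoothPath f) (hg : SmoothPath g) :
    SmoothPath fun t x => f t x - g t x := ContDiff.sub hf hg

lemma toTorus_add_single (y : Fin 2 → ℝ) (j : Fin 2) (h : ℝ) :
    toTorus (y + h • Pi.single j 1) = toTorus y + Pi.single j (h : UnitAddCircle) := by
  ext i
  rcases eq_or_ne i j with rfl | hij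
  · simp [toTorus]
  · simp [toTorus, hij]

lemma SmoothPath.hasDerivAt_lift {f : ℝ → Torus → ℝ} (hf : SmoothPath f) (j : Fin 2) (t : ℝ)
    (y : Fin 2 → ℝ) :
    HasDerivAt (fun h : ℝ => f t (toTorus y + Pi.single j (h : UnitAddCircle)))
      (fderiv ℝ (fun p : ℝ × (Fin 2 → ℝ) => f p.1 (toTorus p.2)) (t, y) (0, Pi.single j 1)) 0 := by
  have hd := (ContDiff.differentiable hf (by simp) (t, y)).hasFDerivAt
  have hl : HasDerivAt (fun h : ℝ => (t, y + h • (Pi.single j 1 : Fin 2 → ℝ)))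
      (0, Pi.single j 1) 0 := by
    refine (hasDerivAt_const _ _).prodMk ?_
    have := ((hasDerivAt_id (0 : ℝ)).smul_const (Pi.single j 1 : Fin 2 → ℝ)).const_add y
    simpa using this
  have := HasFDerivAt.comp_hasDerivAt (x := (0 : ℝ))
    (f := fun h : ℝ => (t, y + h • (Pi.single j 1 : Fin 2 → ℝ)))
    (l := fun p : ℝ × (Fin 2 → ℝ) => f p.1 (toTorus p.2)) (by simpa using hd) hl
  refine this.congr_of_eventuallyEq (Eventually.of_forall fun h => ?_)
  simp only [Function.comp, toTorus_add_single]

/-- On the cover the derivative is a directional Fréchet derivative, hence again smooth. This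
closure property feeds the induction on the order of decay. -/
lemma SmoothPath.partialDeriv {f : ℝ → Torus → ℝ} (hf : SmoothPath f) (j : Fin 2) :
    SmoothPath fun t => partialDeriv j (f t) := by
  have h : (fun p : ℝ × (Fin 2 → ℝ) => ActiveScalar.partialDeriv j (f p.1) (toTorus p.2)) =
      fun p => fderiv ℝ (fun p : ℝ × (Fin 2 → ℝ) => f p.1 (toTorus p.2)) p (0, Pi.single j 1) :=
    funext fun p => (hf.hasDerivAt_lift j p.1 p.2).deriv
  unfold SmoothPath
  rw [h]
  exact (ContDiff.fderiv_right hf (m := ∞) (by simp)).clm_apply contDiff_const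

lemma SmoothPath.hasDerivAt {f : ℝ → Torus → ℝ} (hf : SmoothPath f) (j : Fin 2) (t : ℝ)
    (x : Torus) (h₀ : ℝ) :
    HasDerivAt (fun h : ℝ => f t (x + Pi.single j (h : UnitAddCircle)))
      (ActiveScalar.partialDeriv j (f t) (x + Pi.single j (h₀ : UnitAddCircle))) h₀ := by
  obtain ⟨y, hy⟩ := isOpenQuotientMap_toTorus.surjective (x + Pi.single j (h₀ : UnitAddCircle))
  have h1 : HasDerivAt (fun h : ℝ => f t (x + Pi.single j (h₀ : UnitAddCircle) +
      Pi.single j (h : UnitAddCircle)))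
      (ActiveScalar.partialDeriv j (f t) (x + Pi.single j (h₀ : UnitAddCircle))) (h₀ - h₀) := by
    have := hf.hasDerivAt_lift j t y
    rw [hy] at this
    rw [sub_self]
    exact this.differentiableAt.hasDerivAt
  have h3 := HasDerivAt.comp_sub_const h₀ h₀ h1
  refine h3.congr_of_eventuallyEq (Eventually.of_forall fun h => ?_)
  simp only
  rw [add_assoc, ← Pi.single_add, ← AddCircle.coe_add, add_sub_cancel]

/-- Translation invariance replaces integration by parts: shifting `f` by `h` along axis `j`
multiplies its coefficient by `e^{2πi k_j h}`, and both descriptions are differentiated at `h = 0`.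
-/
lemma SmoothPath.torusCoeff_partialDeriv {f : ℝ → Torus → ℝ} (hf : SmoothPath f) (j : Fin 2)
    (t : ℝ) (k : Freq) :
    torusCoeff (ActiveScalar.partialDeriv j (f t)) k =
      2 * Real.pi * Complex.I * k j * torusCoeff (f t) k := by
  have hdc := (hf.partialDeriv j).continuous_apply t
  have hc := hf.continuous_apply t
  obtain ⟨C, hC⟩ := isCompact_univ.exists_bound_of_continuousOn hdc.continuousOn
  have hadd : ∀ h : ℝ, Continuous fun x : Torus => x + Pi.single j (h : UnitAddCircle) :=
    fun h => by fun_prop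
  set D : Torus → ℝ := ActiveScalar.partialDeriv j (f t) with hD
  let F : ℝ → Torus → ℂ := fun h x =>
    mFourier (-k) x * (f t (x + Pi.single j (h : UnitAddCircle)) : ℂ)
  let F' : ℝ → Torus → ℂ := fun h x =>
    mFourier (-k) x * (D (x + Pi.single j (h : UnitAddCircle)) : ℂ)
  have hF : ∀ h, Continuous (F h) := fun h =>
    (mFourier (-k)).continuous.mul (Complex.continuous_ofReal.comp (hc.comp (hadd h)))
  have hF' : ∀ h, Continuous (F' h) := fun h =>
    (mFourier (-k)).continuous.mul (Complex.continuous_ofReal.comp (hdc.comp (hadd h)))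
  have hFd : ∀ x h, HasDerivAt (fun h => F h x) (F' h x) h := fun x h =>
    ((hf.hasDerivAt j t x h).ofReal_comp).const_mul _
  have hFb : ∀ x h, ‖F' h x‖ ≤ C := fun x h => by
    simp only [F']
    rw [norm_mul, norm_mFourier_apply, one_mul, Complex.norm_real]
    exact hC _ (mem_univ _)
  have hFi : Integrable (F 0) torusMeasure :=
    (hF 0).integrable_of_hasCompactSupport (HasCompactSupport.of_compactSpace _)
  have hder : HasDerivAt (fun h => ∫ x, F h x ∂torusMeasure) (∫ x, F' 0 x ∂torusMeasure) 0 :=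
    (hasDerivAt_integral_of_dominated_loc_of_deriv_le (bound := fun _ => C) univ_mem
      (Eventually.of_forall fun h => (hF h).aestronglyMeasurable) hFi
      (hF' 0).aestronglyMeasurable (ae_of_all _ fun x h _ => hFb x h) (integrable_const C)
      (ae_of_all _ fun x h _ => hFd x h)).2
  have htrans : ∀ h : ℝ, ∫ x, F h x ∂torusMeasure =
      Complex.exp (2 * Real.pi * Complex.I * k j * h) * torusCoeff (f t) k := by
    intro h
    have e := integral_add_right_eq_self (μ := torusMeasure)
      (fun x => mFourier (-k) x * (f t x : ℂ)) (Pi.single j (h : UnitAddCircle))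
    rw [torusCoeff_eq, ← e, ← integral_const_mul]
    refine integral_congr_ae (ae_of_all _ fun x => ?_)
    simp only [F]
    rw [mFourier_add_apply, mFourier_single_coe]
    have : Complex.exp (2 * Real.pi * Complex.I * k j * h) *
        Complex.exp (2 * Real.pi * Complex.I * ((-k) j : ℤ) * h) = 1 := by
      rw [← Complex.exp_add]
      simp
    linear_combination (-(mFourier (-k) x *
      (f t (x + Pi.single j (h : UnitAddCircle)) : ℂ))) * this
  simp only [htrans] at hder
  have hder2 : HasDerivAt (fun h : ℝ => Complex.exp (2 * Real.pi * Complex.I * k j * h) *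
      torusCoeff (f t) k) (2 * Real.pi * Complex.I * k j * torusCoeff (f t) k) 0 := by
    have h2 : HasDerivAt (fun h : ℝ => Complex.exp (2 * Real.pi * Complex.I * k j * h))
        (Complex.exp (2 * Real.pi * Complex.I * k j * (0 : ℝ)) *
          (2 * Real.pi * Complex.I * k j * 1)) 0 :=
      ((HasDerivAt.ofReal_comp (hasDerivAt_id (0 : ℝ))).const_mul _).cexp
    refine (h2.mul_const _).congr_deriv ?_
    simp
  rw [← hder.unique hder2, torusCoeff_eq]
  simp [F']

lemma torusCoeff_sub {g h : Torus → ℝ} (hg : Integrable g torusMeasure)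
    (hh : Integrable h torusMeasure) (k : Freq) :
    torusCoeff (fun x => g x - h x) k = torusCoeff g k - torusCoeff h k := by
  simp only [torusCoeff_eq, Complex.ofReal_sub, mul_sub]
  exact integral_sub (integrable_mFourier_mul hg _) (integrable_mFourier_mul hh _)

lemma torusCoeff_const_mul (c : ℝ) (g : Torus → ℝ) (k : Freq) :
    torusCoeff (fun x => c * g x) k = c * torusCoeff g k := by
  simp only [torusCoeff_eq, Complex.ofReal_mul, mul_left_comm _ (c : ℂ)]
  exact integral_const_mul _ _

lemma norm_torusCoeff_le {g : Torus → ℝ} {C : ℝ} (hg : ∀ x, |g x| ≤ C) (k : Freq) :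
    ‖torusCoeff g k‖ ≤ C := by
  rw [torusCoeff_eq]
  have := norm_integral_le_of_norm_le_const (μ := torusMeasure) (C := C)
    (f := fun x => mFourier (-k) x * (g x : ℂ)) (ae_of_all _ fun x => by
      rw [norm_mul, norm_mFourier_apply, one_mul, Complex.norm_real]; exact hg x)
  simpa using this

/-- The Fourier coefficients of a smooth function decay rapidly, uniformly in time. -/
lemma SmoothPath.exists_decay (T : ℝ) (n : ℕ) : ∀ {f : ℝ → Torus → ℝ}, SmoothPath f →
    ∃ C : ℝ, ∀ t ∈ Icc 0 T, ∀ k, (1 + freqNorm k ^ 2) ^ n * ‖torusCoeff (f t) k‖ ≤ C := by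
  induction n with
  | zero =>
    intro f hf
    obtain ⟨C, hC⟩ := (isCompact_Icc.prod isCompact_univ).exists_bound_of_continuousOn
      (s := Icc 0 T ×ˢ (univ : Set Torus)) hf.continuous.continuousOn
    refine ⟨C, fun t ht k => ?_⟩
    rw [pow_zero, one_mul]
    exact norm_torusCoeff_le (fun x => hC (t, x) ⟨ht, mem_univ _⟩) k
  | succ n ih =>
    intro f hf
    have h0 := (hf.partialDeriv 0).partialDeriv 0
    have h1 := (hf.partialDeriv 1).partialDeriv 1
    -- The induction hypothesis is applied to `(1 - Δ) f`, whose coefficients carry the factor `1 +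
    -- 4π²|k|² ≥ 1 + |k|²`.
    obtain ⟨C, hC⟩ := ih ((hf.sub h0).sub h1)
    refine ⟨C, fun t ht k => le_trans ?_ (hC t ht k)⟩
    rw [torusCoeff_sub ((hf.sub h0).integrable t) (h1.integrable t),
      torusCoeff_sub (hf.integrable t) (h0.integrable t),
      (hf.partialDeriv 0).torusCoeff_partialDeriv, (hf.partialDeriv 1).torusCoeff_partialDeriv,
      hf.torusCoeff_partialDeriv, hf.torusCoeff_partialDeriv]
    have e : torusCoeff (f t) k - 2 * Real.pi * Complex.I * k 0 *
        (2 * Real.pi * Complex.I * k 0 * torusCoeff (f t) k) - 2 * Real.pi * Complex.I * k 1 *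
        (2 * Real.pi * Complex.I * k 1 * torusCoeff (f t) k) =
        ((1 + (2 * Real.pi) ^ 2 * freqNorm k ^ 2 : ℝ) : ℂ) * torusCoeff (f t) k := by
      rw [freqNorm_sq]
      push_cast
      linear_combination (-(2 * Real.pi) ^ 2 * ((k 0) ^ 2 + (k 1) ^ 2) * torusCoeff (f t) k) *
        Complex.I_sq
    rw [e, norm_mul, Complex.norm_real, Real.norm_of_nonneg (by positivity), pow_succ, mul_assoc]
    refine mul_le_mul_of_nonneg_left ?_ (pow_nonneg (weight_base_pos k).le n)
    refine mul_le_mul_of_nonneg_right ?_ (norm_nonneg _)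
    have hpi : 1 ≤ (2 * Real.pi) ^ 2 := by nlinarith [Real.pi_gt_three]
    nlinarith [sq_nonneg (freqNorm k)]

lemma SmoothPath.energy_lt_top {f : ℝ → Torus → ℝ} (hf : SmoothPath f) (r T : ℝ) :
    energy r (fun t k => torusCoeff (f t) k) T < ⊤ := by
  -- Decay of order `n` appears squared, and `r ≤ 2n - 2` leaves the summable weight of exponent
  -- `-2`.
  obtain ⟨n, hn⟩ := exists_nat_ge (r + 2)
  obtain ⟨C, hC⟩ := hf.exists_decay T n
  have hpt : ∀ t ∈ Ioo 0 T, sobolevSq r (fun k => torusCoeff (f t) k) ≤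
      ENNReal.ofReal (C ^ 2) * ∑' k, sobolevWeight (-2) k := by
    intro t ht
    rw [← ENNReal.tsum_mul_left]
    refine ENNReal.tsum_le_tsum fun k => ?_
    have hb := weight_base_pos k
    rw [sobolevWeight, sobolevWeight, ← ofReal_norm, ← ENNReal.ofReal_pow (norm_nonneg _),
      ← ENNReal.ofReal_mul (Real.rpow_nonneg hb.le _), ← ENNReal.ofReal_mul (sq_nonneg C)]
    refine ENNReal.ofReal_le_ofReal ?_
    have h1 := hC t (Ioo_subset_Icc_self ht) k
    have h2 : ((1 + freqNorm k ^ 2) ^ n * ‖torusCoeff (f t) k‖) ^ 2 ≤ C ^ 2 :=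
      pow_le_pow_left₀ (mul_nonneg (pow_nonneg hb.le n) (norm_nonneg _)) h1 2
    have h3 : (1 + freqNorm k ^ 2) ^ r ≤
        ((1 + freqNorm k ^ 2) ^ n) ^ 2 * (1 + freqNorm k ^ 2) ^ (-2 : ℝ) := by
      rw [← pow_mul, ← Real.rpow_natCast (1 + freqNorm k ^ 2) (n * 2), ← Real.rpow_add hb]
      refine Real.rpow_le_rpow_of_exponent_le (one_le_weight_base k) ?_
      push_cast
      have : (0 : ℝ) ≤ n := n.cast_nonneg
      linarith
    calc (1 + freqNorm k ^ 2) ^ r * ‖torusCoeff (f t) k‖ ^ 2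
        ≤ (((1 + freqNorm k ^ 2) ^ n) ^ 2 * (1 + freqNorm k ^ 2) ^ (-2 : ℝ)) *
          ‖torusCoeff (f t) k‖ ^ 2 := mul_le_mul_of_nonneg_right h3 (sq_nonneg _)
      _ = ((1 + freqNorm k ^ 2) ^ n * ‖torusCoeff (f t) k‖) ^ 2 *
          (1 + freqNorm k ^ 2) ^ (-2 : ℝ) := by ring
      _ ≤ _ := mul_le_mul_of_nonneg_right h2 (Real.rpow_nonneg hb.le _)
  refine (setLIntegral_mono' measurableSet_Ioo hpt).trans_lt ?_
  rw [lintegral_const, Measure.restrict_apply_univ, Real.volume_Ioo]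
  have : ∑' k, sobolevWeight (-2) k ≠ ⊤ := (tsum_sobolevWeight_lt_top (by norm_num)).ne
  finiteness

end ActiveScalar

end

noncomputable section

namespace ActiveScalar

/-! ### Coefficients of time-dependent `L²` functions -/

lemma torusCoeff_congr_ae {g h : Torus → ℝ} (hgh : g =ᵐ[torusMeasure] h) (k : Freq) :
    torusCoeff g k = torusCoeff h k := by
  rw [torusCoeff_eq, torusCoeff_eq]
  refine integral_congr_ae ?_
  filter_upwards [hgh] with x hx
  rw [hx]

lemma torusCoeff_L2_sub (g h : L2Torus) (k : Freq) :
    torusCoeff (g - h : L2Torus) k = torusCoeff g k - torusCoeff h k := by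
  rw [torusCoeff_congr_ae (Lp.coeFn_sub g h)]
  exact torusCoeff_sub (integrable_L2Torus g) (integrable_L2Torus h) k

lemma torusCoeff_L2_smul (c : ℝ) (g : L2Torus) (k : Freq) :
    torusCoeff (c • g : L2Torus) k = c * torusCoeff g k := by
  rw [torusCoeff_congr_ae (Lp.coeFn_smul c g)]
  exact torusCoeff_const_mul c g k

lemma torusCoeff_L2_add (g h : L2Torus) (k : Freq) :
    torusCoeff (g + h : L2Torus) k = torusCoeff g k + torusCoeff h k := by
  rw [← sub_neg_eq_add, torusCoeff_L2_sub, ← neg_one_smul ℝ h, torusCoeff_L2_smul]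
  push_cast
  ring

lemma aemeasurable_torusCoeff {μ : Measure ℝ} {v : ℝ → L2Torus} (hv : AEStronglyMeasurable v μ)
    (k : Freq) : AEMeasurable (fun t => torusCoeff (v t) k) μ :=
  ((continuous_torusCoeff k).comp_aestronglyMeasurable hv).aemeasurable

lemma aemeasurable_sobolevSq {μ : Measure ℝ} (r : ℝ) {F : ℝ → Freq → ℂ}
    (hF : ∀ k, AEMeasurable (fun t => F t k) μ) : AEMeasurable (fun t => sobolevSq r (F t)) μ := by
  unfold sobolevSq
  exact AEMeasurable.tsum fun k => ((hF k).enorm.pow_const 2).const_mul _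

lemma bochnerNorm_two (r T : ℝ) (v : ℝ → L2Torus) :
    bochnerNorm 2 r T v = energy r (fun t => torusCoeff (v t)) T ^ (1 / 2 : ℝ) := by
  rw [bochnerNorm, eLpNorm_eq_lintegral_rpow_enorm_toReal (by norm_num) (by norm_num), energy]
  simp only [enorm_eq_self, ENNReal.toReal_ofNat, ENNReal.rpow_two, sobolevNorm_sq]

lemma MemBochner.energy_lt_top {r T : ℝ} {v : ℝ → L2Torus} (h : MemBochner 2 r T v) :
    energy r (fun t => torusCoeff (v t)) T < ⊤ := by
  have := h.2
  rw [bochnerNorm_two] at this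
  by_contra! h'
  rw [top_le_iff.mp h', ENNReal.top_rpow_of_pos (by norm_num)] at this
  exact lt_irrefl _ this

lemma MemBochner.exists_bound {r T : ℝ} {v : ℝ → L2Torus} (h : MemBochner ⊤ r T v) :
    ∃ M : ℝ≥0∞, M ≠ ⊤ ∧
      ∀ᵐ t ∂volume.restrict (Ioo 0 T), sobolevSq r (torusCoeff (v t)) ≤ M := by
  refine ⟨bochnerNorm ⊤ r T v ^ 2, ENNReal.pow_ne_top h.2.ne, ?_⟩
  filter_upwards [ae_le_eLpNormEssSup (μ := volume.restrict (Ioo 0 T))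
    (f := fun t => sobolevNorm r (v t))] with t ht
  rw [← sobolevNorm_sq, bochnerNorm, eLpNorm_exponent_top]
  exact pow_le_pow_left' ht 2

lemma bochnerNorm_top_le {r T : ℝ} {v : ℝ → L2Torus} {M : ℝ≥0∞}
    (h : ∀ᵐ t ∂volume.restrict (Ioo 0 T), sobolevSq r (torusCoeff (v t)) ≤ M) :
    bochnerNorm ⊤ r T v ≤ M ^ (1 / 2 : ℝ) := by
  rw [bochnerNorm, eLpNorm_exponent_top]
  refine essSup_le_of_ae_le _ ?_
  filter_upwards [h] with t ht
  rw [enorm_eq_self, sobolevNorm_eq]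
  exact ENNReal.rpow_le_rpow ht (by norm_num)

lemma integrableOn_of_energy_lt_top {r T : ℝ} {F : ℝ → Freq → ℂ} {k : Freq}
    (hF : AEMeasurable (fun t => F t k) (volume.restrict (Ioo 0 T))) (h : energy r F T < ⊤) :
    IntegrableOn (fun t => F t k) (Ioo 0 T) := by
  have hle : sobolevWeight r k * ∫⁻ t in Ioo 0 T, ‖F t k‖ₑ ^ 2 ≤ energy r F T := by
    rw [← lintegral_const_mul' _ _ (sobolevWeight_ne_top r k)]
    exact lintegral_mono fun t => ENNReal.le_tsum (f := fun k => sobolevWeight r k * ‖F t k‖ₑ ^ 2) k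
  have hlt : ∫⁻ t in Ioo 0 T, ‖F t k‖ₑ ^ 2 < ⊤ := by
    by_contra! h'
    rw [top_le_iff.mp h', ENNReal.mul_top (sobolevWeight_ne_zero r k), top_le_iff] at hle
    exact h.ne hle
  have hmem : MemLp (fun t => F t k) 2 (volume.restrict (Ioo 0 T)) := by
    refine ⟨hF.aestronglyMeasurable, ?_⟩
    rw [eLpNorm_lt_top_iff_lintegral_rpow_enorm_lt_top (by norm_num) (by norm_num)]
    simpa using hlt
  exact hmem.integrable (by norm_num)

lemma energy_add_le (r : ℝ) {T t : ℝ} (ht : t ≤ T) {F G : ℝ → Freq → ℂ}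
    (hF : ∀ k, AEMeasurable (fun t => F t k) (volume.restrict (Ioo 0 T))) :
    energy r (fun t k => F t k + G t k) t ≤ 2 * energy r F t + 2 * energy r G t := by
  have hF' : ∀ k, AEMeasurable (fun t => F t k) (volume.restrict (Ioo 0 t)) := fun k =>
    (hF k).mono_measure (Measure.restrict_mono (Ioo_subset_Ioo_right ht) le_rfl)
  unfold energy
  rw [← lintegral_const_mul' _ _ (by norm_num), ← lintegral_const_mul' _ _ (by norm_num),
    ← lintegral_add_left' ((aemeasurable_sobolevSq r hF').const_mul 2)]
  exact lintegral_mono fun t => sobolevSq_add_le r (F t) (G t)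

lemma energy_const_mul (r : ℝ) (c : ℂ) (F : ℝ → Freq → ℂ) (t : ℝ) :
    energy r (fun t k => c * F t k) t = ‖c‖ₑ ^ 2 * energy r F t := by
  simp only [energy, sobolevSq_const_mul]
  exact lintegral_const_mul' _ _ (by finiteness)

lemma energy_neg (r : ℝ) (F : ℝ → Freq → ℂ) (t : ℝ) :
    energy r (fun t k => -F t k) t = energy r F t := by
  simp only [energy, sobolevSq_neg]

lemma energy_mono_time (r : ℝ) (F : ℝ → Freq → ℂ) {t T : ℝ} (h : t ≤ T) :
    energy r F t ≤ energy r F T := lintegral_mono_set (Ioo_subset_Ioo_right h)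

lemma energy_mono (F : ℝ → Freq → ℂ) {r q : ℝ} (h : r ≤ q) (t : ℝ) :
    energy r F t ≤ energy q F t := lintegral_mono fun _ => sobolevSq_mono h _

/-! ### Linearity of Duhamel's formula -/

lemma duhamel_congr_ae (lam : ℝ) {T t : ℝ} (ht : t ≤ T) {F G : ℝ → ℂ}
    (h : ∀ᵐ τ ∂volume.restrict (Ioo 0 T), F τ = G τ) : duhamel lam F t = duhamel lam G t := by
  refine integral_congr_ae ?_
  filter_upwards [ae_restrict_of_ae_restrict_of_subset (Ioo_subset_Ioo_right ht) h] with τ hτ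
  rw [hτ]

lemma integrableOn_exp_mul (lam : ℝ) {T t : ℝ} (ht : t ≤ T) {F : ℝ → ℂ}
    (hF : IntegrableOn F (Ioo 0 T)) :
    IntegrableOn (fun τ => (Real.exp (-(lam * (t - τ))) : ℂ) * F τ) (Ioo 0 t) := by
  have hc : Continuous fun τ : ℝ => (Real.exp (-(lam * (t - τ))) : ℂ) := by fun_prop
  obtain ⟨C, hC⟩ := isCompact_Icc.exists_bound_of_continuousOn (s := Icc 0 t) hc.continuousOn
  exact (hF.mono_set (Ioo_subset_Ioo_right ht)).bdd_mul hc.aestronglyMeasurable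
    ((ae_restrict_iff' measurableSet_Ioo).mpr
      (ae_of_all _ fun τ hτ => hC τ (Ioo_subset_Icc_self hτ)))

lemma duhamel_add (lam : ℝ) {T t : ℝ} (ht : t ≤ T) {F G : ℝ → ℂ} (hF : IntegrableOn F (Ioo 0 T))
    (hG : IntegrableOn G (Ioo 0 T)) :
    duhamel lam (fun τ => F τ + G τ) t = duhamel lam F t + duhamel lam G t := by
  simp only [duhamel, mul_add]
  exact integral_add (integrableOn_exp_mul lam ht hF) (integrableOn_exp_mul lam ht hG)

lemma duhamel_const_mul (lam t : ℝ) (c : ℂ) (F : ℝ → ℂ) :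
    duhamel lam (fun τ => c * F τ) t = c * duhamel lam F t := by
  simp only [duhamel, mul_left_comm _ c]
  exact integral_const_mul _ _

lemma SmoothPath.integrableOn_torusCoeff {f : ℝ → Torus → ℝ} (hf : SmoothPath f) (T : ℝ)
    (k : Freq) : IntegrableOn (fun t => torusCoeff (f t) k) (Ioo 0 T) :=
  (hf.continuous_torusCoeff k).integrableOn_Icc.mono_set Ioo_subset_Icc_self

lemma SmoothPath.aemeasurable_torusCoeff {f : ℝ → Torus → ℝ} (hf : SmoothPath f) (T : ℝ)
    (k : Freq) : AEMeasurable (fun t => torusCoeff (f t) k) (volume.restrict (Ioo 0 T)) :=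
  (hf.continuous_torusCoeff k).measurable.aemeasurable

lemma IsLinearSolution.torusCoeff_eq_duhamel {α T : ℝ} {f : ℝ → Torus → ℝ} {w : ℝ → L2Torus}
    (hf : SmoothPath f) (hw : IsLinearSolution α T f w) :
    ∀ᵐ t ∂volume.restrict (Ioo 0 T), ∀ k,
      torusCoeff (w t) k = duhamel (heatRate α k) (fun τ => torusCoeff (f τ) k) t :=
  ae_all_iff.mpr fun k => ActiveScalar.torusCoeff_eq_duhamel hw.solves
    (ae_of_all _ fun t => hf.integrable t) k
    (integrableOn_of_energy_lt_top (aemeasurable_torusCoeff hw.memL2.1 k) hw.memL2.energy_lt_top)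
    (hf.integrableOn_torusCoeff T k)

/-! ### A continuity argument -/

/-- If `E(t) = ∫₀ᵗ h` satisfies `E ≤ δ + B E²` with `4 B δ < 1`, then `E ≤ 2 δ`. -/
lemma lintegral_le_of_quadratic {T : ℝ} (hT : 0 < T) {h : ℝ → ℝ≥0∞}
    (hm : AEMeasurable h (volume.restrict (Ioo 0 T))) (hfin : ∫⁻ τ in Ioo 0 T, h τ ≠ ⊤)
    {δ B : ℝ} (hδ : 0 < δ) (hB : 0 ≤ B) (hsmall : 4 * B * δ < 1)
    (hq : ∀ t ∈ Icc 0 T, ∫⁻ τ in Ioo 0 t, h τ ≤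
      ENNReal.ofReal δ + ENNReal.ofReal B * (∫⁻ τ in Ioo 0 t, h τ) ^ 2) :
    ∫⁻ τ in Ioo 0 T, h τ ≤ ENNReal.ofReal (2 * δ) := by
  have hint : IntegrableOn (fun τ => (h τ).toReal) (Icc 0 T) := by
    rw [integrableOn_Icc_iff_integrableOn_Ioo]
    exact integrable_toReal_of_lintegral_ne_top hm hfin
  set e : ℝ → ℝ := fun t => ∫ τ in Ioc 0 t, (h τ).toReal with he
  have hec : ContinuousOn e (Icc 0 T) := intervalIntegral.continuousOn_primitive hint
  have heE : ∀ t ∈ Icc 0 T, ∫⁻ τ in Ioo 0 t, h τ = ENNReal.ofReal (e t) := by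
    intro t ht
    have hfin' : ∫⁻ τ in Ioo 0 t, h τ ≠ ⊤ :=
      ne_top_of_le_ne_top hfin (lintegral_mono_set (Ioo_subset_Ioo_right ht.2))
    have hm' : AEMeasurable h (volume.restrict (Ioo 0 t)) :=
      hm.mono_measure (Measure.restrict_mono (Ioo_subset_Ioo_right ht.2) le_rfl)
    simp only [he]
    rw [integral_Ioc_eq_integral_Ioo, integral_toReal hm' (ae_lt_top' hm' hfin'),
      ENNReal.ofReal_toReal hfin']
  have he0 : ∀ t, 0 ≤ e t := fun t => integral_nonneg fun τ => ENNReal.toReal_nonneg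
  have hqe : ∀ t ∈ Icc 0 T, e t ≤ δ + B * e t ^ 2 := by
    intro t ht
    have := hq t ht
    rw [heE t ht, ← ENNReal.ofReal_pow (he0 t), ← ENNReal.ofReal_mul hB,
      ← ENNReal.ofReal_add hδ.le (by have := he0 t; positivity)] at this
    exact (ENNReal.ofReal_le_ofReal_iff (by have := he0 t; positivity)).mp this
  rw [heE T ⟨hT.le, le_rfl⟩]
  refine ENNReal.ofReal_le_ofReal ?_
  by_contra! hlt
  have h0 : e 0 = 0 := by simp [he]
  -- If the bound failed, the value `2δ` would be attained, but there the hypothesis reads `2δ ≤ δ +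
  -- 4Bδ² < 2δ`.
  obtain ⟨t, ht, hte⟩ := intermediate_value_Icc hT.le hec
    (show 2 * δ ∈ Icc (e 0) (e T) from ⟨by rw [h0]; positivity, hlt.le⟩)
  have := hqe t ht
  rw [hte] at this
  nlinarith

end ActiveScalar

end

noncomputable section

namespace ActiveScalar

/-! ### The active scalar equation on the Fourier side -/

/-- The Fourier coefficients of `ℛθ · ∇θ` in terms of those of `θ`. -/
def transportCoeff (K : Torus → ℝ) (a : Freq → ℂ) (k : Freq) : ℂ :=
  ∑' l, transportSymbol K k l * a l * a (k - l)

lemma exists_sobolevSq_transportCoeff_le {α s : ℝ} (hα : 1 / 2 < α) (hα' : α < 1)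
    (hs : 2 < s + α) {K : Torus → ℝ} (hK : IsAdmissibleKernel K) :
    ∃ B : ℝ≥0∞, B ≠ ⊤ ∧ ∀ a : Freq → ℂ,
      sobolevSq (s - α) (transportCoeff K a) ≤ B * (sobolevSq s a * sobolevSq (s + α) a) := by
  obtain ⟨C, hC, hprod⟩ := exists_sobolevSq_product_le hα hα' hs
  obtain ⟨c, hc, hsym⟩ := exists_transportSymbol_le hK
  refine ⟨c ^ 2 * C, by finiteness, fun a => hprod a _ c fun k => ?_⟩
  refine enorm_tsum_le_tsum_enorm.trans ?_
  rw [← ENNReal.tsum_mul_left]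
  refine ENNReal.tsum_le_tsum fun l => ?_
  rw [enorm_mul, enorm_mul]
  calc ‖transportSymbol K k l‖ₑ * ‖a l‖ₑ * ‖a (k - l)‖ₑ
      ≤ (c * sobolevWeight (1 / 2) (k - l)) * ‖a l‖ₑ * ‖a (k - l)‖ₑ := by
        gcongr
        exact hsym k l
    _ = _ := by ring

/-- The Fourier side of an active scalar solution. -/
lemma IsActiveScalarSolution.fourier {α s T : ℝ} (hα' : α < 1) (hs : 2 < s + α) {K : Torus → ℝ}
    (hK : IsAdmissibleKernel K) {B : ℝ≥0∞} (hB : B ≠ ⊤)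
    (hBK : ∀ a : Freq → ℂ,
      sobolevSq (s - α) (transportCoeff K a) ≤ B * (sobolevSq s a * sobolevSq (s + α) a))
    {g : ℝ → Torus → ℝ} (hg : SmoothPath g) {θ : ℝ → L2Torus}
    (hθ : IsActiveScalarSolution α s T K g θ) :
    (∀ k, AEMeasurable (fun t => transportCoeff K (torusCoeff (θ t)) k)
      (volume.restrict (Ioo 0 T))) ∧
    energy (s - α) (fun t => transportCoeff K (torusCoeff (θ t))) T < ⊤ ∧
    ∀ᵐ t ∂volume.restrict (Ioo 0 T), ∀ k, torusCoeff (θ t) k = duhamel (heatRate α k)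
      (fun τ => torusCoeff (g τ) k + -transportCoeff K (torusCoeff (θ τ)) k) t := by
  obtain ⟨u, G, huG, hsol⟩ := hθ.solves
  obtain ⟨M, hM, hbound⟩ := hθ.memLinfty.exists_bound
  have htr : ∀ᵐ t ∂volume.restrict (Ioo 0 T),
      Integrable (fun x => ∑ j, u t j x * G t j x) torusMeasure ∧
      ∀ k, HasSum (fun l => transportSymbol K k l * torusCoeff (θ t) l * torusCoeff (θ t) (k - l))
        (torusCoeff (fun x => ∑ j, u t j x * G t j x) k) := by
    filter_upwards [huG, hbound] with t ht hb
    exact torusCoeff_transport hK (integrable_L2Torus (θ t))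
      (summable_norm_of_sobolevSq (by linarith) (hb.trans_lt hM.lt_top)) ht.1 ht.2
  have hmeas := fun k => aemeasurable_torusCoeff hθ.memL2.1 k
  -- No joint measurability of `u` and `G` is assumed; the coefficients of the transport term are
  -- a.e. limits of finite sums of measurable products of coefficients of `θ`.
  have hNm : ∀ k, AEMeasurable (fun t => transportCoeff K (torusCoeff (θ t)) k)
      (volume.restrict (Ioo 0 T)) := by
    intro k
    refine aemeasurable_of_tendsto_metrizable_ae atTop (f := fun (S : Finset Freq) t =>
      ∑ l ∈ S, transportSymbol K k l * torusCoeff (θ t) l * torusCoeff (θ t) (k - l))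
      (fun S => Finset.aemeasurable_fun_sum S fun l _ =>
        ((hmeas l).const_mul _).mul (hmeas (k - l))) ?_
    filter_upwards [htr] with t ht
    exact (ht.2 k).summable.hasSum
  -- The solution class is exactly what the product estimate needs: one factor is bounded in time,
  -- the other square integrable. The continuity argument starts from this finiteness.
  have hNe : energy (s - α) (fun t => transportCoeff K (torusCoeff (θ t))) T < ⊤ := by
    calc energy (s - α) (fun t => transportCoeff K (torusCoeff (θ t))) T
        ≤ ∫⁻ t in Ioo 0 T, B * M * sobolevSq (s + α) (torusCoeff (θ t)) := by
          refine lintegral_mono_ae ?_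
          filter_upwards [hbound] with t ht
          refine (hBK _).trans ?_
          rw [mul_assoc]
          gcongr
      _ = B * M * energy (s + α) (fun t => torusCoeff (θ t)) T :=
          lintegral_const_mul' _ _ (by finiteness)
      _ < ⊤ := by
          have := hθ.memL2.energy_lt_top
          finiteness
  refine ⟨hNm, hNe, ae_all_iff.mpr fun k => ?_⟩
  have hFeq : ∀ᵐ t ∂volume.restrict (Ioo 0 T),
      torusCoeff (fun x => g t x - ∑ j, u t j x * G t j x) k =
        torusCoeff (g t) k + -transportCoeff K (torusCoeff (θ t)) k := by
    filter_upwards [htr] with t ht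
    rw [torusCoeff_sub (hg.integrable t) ht.1, ← (ht.2 k).tsum_eq, ← sub_eq_add_neg]
    rfl
  have hFi : IntegrableOn
      (fun t => torusCoeff (g t) k + -transportCoeff K (torusCoeff (θ t)) k) (Ioo 0 T) :=
    (hg.integrableOn_torusCoeff T k).add (integrableOn_of_energy_lt_top (hNm k) hNe).neg
  have key := torusCoeff_eq_duhamel hsol
    (by filter_upwards [htr] with t ht using (hg.integrable t).sub ht.1) k
    (integrableOn_of_energy_lt_top (hmeas k) hθ.memL2.energy_lt_top)
    (hFi.congr (hFeq.mono fun t ht => ht.symm))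
  filter_upwards [key, ae_restrict_mem measurableSet_Ioo] with t ht htT
  rw [ht]
  exact duhamel_congr_ae _ htT.2.le hFeq

/-- The quadratic bound for the transport term in terms of the total forcing. -/
lemma energy_transportCoeff_le {α s T : ℝ} (hα : 0 < α) (hT : 0 ≤ T) {K : Torus → ℝ}
    {B : ℝ≥0∞} (hB : B ≠ ⊤)
    (hBK : ∀ a : Freq → ℂ,
      sobolevSq (s - α) (transportCoeff K a) ≤ B * (sobolevSq s a * sobolevSq (s + α) a))
    {a F : ℝ → Freq → ℂ} (hF : ∀ k, AEMeasurable (fun t => F t k) (volume.restrict (Ioo 0 T)))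
    (hFe : energy (s - α) F T < ⊤)
    (hm : ∀ k, AEMeasurable (fun t => a t k) (volume.restrict (Ioo 0 T)))
    (ha : ∀ᵐ t ∂volume.restrict (Ioo 0 T), ∀ k,
      a t k = duhamel (heatRate α k) (fun τ => F τ k) t) {t₀ : ℝ} (ht₀ : t₀ ≤ T) :
    energy (s - α) (fun t => transportCoeff K (a t)) t₀ ≤
      B * ENNReal.ofReal (1 + T) ^ 3 * energy (s - α) F t₀ ^ 2 := by
  set P := ENNReal.ofReal (1 + T) with hP
  set E := energy (s - α) F t₀ with hE
  have hEfin : E ≠ ⊤ := ((energy_mono_time _ F ht₀).trans_lt hFe).ne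
  have hPfin : P ≠ ⊤ := ENNReal.ofReal_ne_top
  -- The power `P ^ 3` is one factor from the `L^∞H^s` bound and two from the `L²H^{s+α}` bound.
  calc energy (s - α) (fun t => transportCoeff K (a t)) t₀
      ≤ ∫⁻ t in Ioo 0 t₀, B * (P * E) * sobolevSq (s + α) (a t) := by
        refine lintegral_mono_ae ?_
        filter_upwards [ae_restrict_of_ae_restrict_of_subset (Ioo_subset_Ioo_right ht₀) ha,
          ae_restrict_mem measurableSet_Ioo] with t ht htt
        refine (hBK _).trans ?_
        rw [mul_assoc]
        gcongr
        exact sobolevSq_le_energy hα hT htt.2.le ht₀ hF ht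
    _ = B * (P * E) * energy (s + α) a t₀ := lintegral_const_mul' _ _ (by finiteness)
    _ ≤ B * (P * E) * (P ^ 2 * E) := by
        gcongr
        exact energy_le_energy hα hT ht₀ hF hm ha
    _ = _ := by ring

/-! ### Linearisation -/

/-- `v_ε - v₀` is `O(ε)` in `L²(0, T; H^{2α}) ∩ L^∞(0, T; H^α)`. -/
def ConvergesLinearly (α T : ℝ) (v : ℝ → ℝ → L2Torus) (v₀ : ℝ → L2Torus) : Prop :=
  ∃ Q : ℝ≥0∞, Q ≠ ⊤ ∧ ∀ᶠ ε : ℝ in 𝓝[≠] 0,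
    (∀ k, AEMeasurable (fun t => torusCoeff (v ε t - v₀ t : L2Torus) k)
      (volume.restrict (Ioo 0 T))) ∧
    energy (2 * α) (fun t => torusCoeff (v ε t - v₀ t : L2Torus)) T ≤ Q * ‖ε‖ₑ ^ 2 ∧
    ∀ᵐ t ∂volume.restrict (Ioo 0 T),
      sobolevSq α (torusCoeff (v ε t - v₀ t : L2Torus)) ≤ Q * ‖ε‖ₑ ^ 2

lemma ConvergesLinearly.convergesTo {α T : ℝ} {v : ℝ → ℝ → L2Torus} {v₀ : ℝ → L2Torus}
    (h : ConvergesLinearly α T v v₀) : ConvergesTo α T v v₀ := by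
  obtain ⟨Q, hQ, hev⟩ := h
  have hlim : Tendsto (fun ε : ℝ => (Q * ‖ε‖ₑ ^ 2) ^ (1 / 2 : ℝ)) (𝓝[≠] 0) (𝓝 0) := by
    have h1 : Tendsto (fun ε : ℝ => ‖ε‖ₑ ^ 2) (𝓝[≠] 0) (𝓝 0) := by
      have : Tendsto (fun ε : ℝ => ‖ε‖ₑ ^ 2) (𝓝 0) (𝓝 (‖(0 : ℝ)‖ₑ ^ 2)) :=
        (ENNReal.continuous_pow 2).continuousAt.tendsto.comp continuous_enorm.continuousAt
      rw [enorm_zero, zero_pow two_ne_zero] at this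
      exact this.mono_left nhdsWithin_le_nhds
    have h2 := (ENNReal.Tendsto.const_mul h1 (Or.inr hQ)).ennrpow_const (1 / 2 : ℝ)
    rwa [mul_zero, ENNReal.zero_rpow_of_pos (by norm_num)] at h2
  refine ⟨tendsto_of_tendsto_of_tendsto_of_le_of_le' tendsto_const_nhds hlim
    (Eventually.of_forall fun _ => zero_le) ?_, tendsto_of_tendsto_of_tendsto_of_le_of_le'
    tendsto_const_nhds hlim (Eventually.of_forall fun _ => zero_le) ?_⟩
  · filter_upwards [hev] with ε hε
    rw [bochnerNorm_two]
    exact ENNReal.rpow_le_rpow hε.2.1 (by norm_num)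
  · filter_upwards [hev] with ε hε
    exact bochnerNorm_top_le hε.2.2

lemma ConvergesLinearly.sub {α T : ℝ} {v v' : ℝ → ℝ → L2Torus} {v₀ v₀' : ℝ → L2Torus}
    (h : ConvergesLinearly α T v v₀) (h' : ConvergesLinearly α T v' v₀') :
    ConvergesLinearly α T (fun ε t => v ε t - v' ε t) (fun t => v₀ t - v₀' t) := by
  obtain ⟨Q, hQ, hev⟩ := h
  obtain ⟨Q', hQ', hev'⟩ := h'
  refine ⟨2 * Q + 2 * Q', by finiteness, ?_⟩
  filter_upwards [hev, hev'] with ε ⟨hm, he, hs⟩ ⟨hm', he', hs'⟩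
  have hc : ∀ t, torusCoeff (v ε t - v' ε t - (v₀ t - v₀' t) : L2Torus) = fun k =>
      torusCoeff (v ε t - v₀ t : L2Torus) k + -torusCoeff (v' ε t - v₀' t : L2Torus) k := by
    intro t
    ext k
    rw [torusCoeff_L2_sub, torusCoeff_L2_sub, torusCoeff_L2_sub, torusCoeff_L2_sub,
      torusCoeff_L2_sub]
    ring
  simp only [hc]
  refine ⟨fun k => (hm k).add (hm' k).neg, ?_, ?_⟩
  · refine (energy_add_le _ le_rfl hm).trans ?_
    rw [energy_neg (2 * α) fun t => torusCoeff (v' ε t - v₀' t : L2Torus)]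
    calc _ ≤ 2 * (Q * ‖ε‖ₑ ^ 2) + 2 * (Q' * ‖ε‖ₑ ^ 2) := by gcongr
      _ = _ := by ring
  · filter_upwards [hs, hs'] with t ht ht'
    refine (sobolevSq_add_le _ _ _).trans ?_
    rw [sobolevSq_neg α (torusCoeff (v' ε t - v₀' t : L2Torus))]
    calc _ ≤ 2 * (Q * ‖ε‖ₑ ^ 2) + 2 * (Q' * ‖ε‖ₑ ^ 2) := by gcongr
      _ = _ := by ring

/-- Small data bound: the forcing of the Fourier modes, including the transport term, is
`O(ε)`. -/
lemma energy_forcing_le {α s T : ℝ} (hα : 0 < α) (hT : 0 < T) {K : Torus → ℝ}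
    {B : ℝ≥0∞} (hB : B ≠ ⊤)
    (hBK : ∀ a : Freq → ℂ,
      sobolevSq (s - α) (transportCoeff K a) ≤ B * (sobolevSq s a * sobolevSq (s + α) a))
    {a g : ℝ → Freq → ℂ}
    (hg : ∀ k, AEMeasurable (fun t => g t k) (volume.restrict (Ioo 0 T)))
    (hN : ∀ k, AEMeasurable (fun t => transportCoeff K (a t) k) (volume.restrict (Ioo 0 T)))
    (hNe : energy (s - α) (fun t => transportCoeff K (a t)) T < ⊤)
    (hm : ∀ k, AEMeasurable (fun t => a t k) (volume.restrict (Ioo 0 T)))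
    (ha : ∀ᵐ t ∂volume.restrict (Ioo 0 T), ∀ k, a t k =
      duhamel (heatRate α k) (fun τ => g τ k + -transportCoeff K (a τ) k) t)
    {δ : ℝ} (hδ : 0 < δ) (hgδ : 2 * energy (s - α) g T ≤ ENNReal.ofReal δ)
    (hsmall : 4 * (2 * (B * ENNReal.ofReal (1 + T) ^ 3)).toReal * δ < 1) :
    energy (s - α) (fun t k => g t k + -transportCoeff K (a t) k) T ≤ ENNReal.ofReal (2 * δ) := by
  have hFm : ∀ k, AEMeasurable (fun t => g t k + -transportCoeff K (a t) k)
      (volume.restrict (Ioo 0 T)) := fun k => (hg k).add (hN k).neg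
  have hsplit : ∀ t ≤ T, energy (s - α) (fun t k => g t k + -transportCoeff K (a t) k) t ≤
      2 * energy (s - α) g t + 2 * energy (s - α) (fun t => transportCoeff K (a t)) t := by
    intro t ht
    refine (energy_add_le _ ht hg).trans ?_
    rw [energy_neg _ fun t => transportCoeff K (a t)]
  have hFe : energy (s - α) (fun t k => g t k + -transportCoeff K (a t) k) T < ⊤ := by
    refine (hsplit T le_rfl).trans_lt (ENNReal.add_lt_top.mpr ⟨?_, by finiteness⟩)
    exact hgδ.trans_lt ENNReal.ofReal_lt_top
  -- The total forcing is source plus transport, and transport is quadratic in the total forcing;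
  -- the factor `2` in the quadratic coefficient comes from splitting the squared norm.
  refine lintegral_le_of_quadratic hT (aemeasurable_sobolevSq _ hFm) hFe.ne hδ
    ENNReal.toReal_nonneg hsmall fun t ht => ?_
  rw [ENNReal.ofReal_toReal (by finiteness)]
  refine (hsplit t ht.2).trans (add_le_add ?_ ?_)
  · refine le_trans ?_ hgδ
    gcongr
    exact energy_mono_time _ _ ht.2
  · rw [mul_assoc]
    gcongr
    exact energy_transportCoeff_le hα hT.le hB hBK hFm hFe hm ha ht.2

/-- The first order linearisation of the active scalar equation at the zero solution. -/
lemma convergesLinearly_of_solutions {α s T : ℝ} (hα : 1 / 2 < α) (hα' : α < 1)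
    (hs : 2 < s + α) (hT : 0 < T) {K : Torus → ℝ} (hK : IsAdmissibleKernel K)
    {f : ℝ → Torus → ℝ} (hf : SmoothPath f) {w : ℝ → L2Torus}
    (hwm : ∀ k, AEMeasurable (fun t => torusCoeff (w t) k) (volume.restrict (Ioo 0 T)))
    (hw : ∀ᵐ t ∂volume.restrict (Ioo 0 T), ∀ k,
      torusCoeff (w t) k = duhamel (heatRate α k) (fun τ => torusCoeff (f τ) k) t)
    {θ : ℝ → ℝ → L2Torus} (hθ : ∀ᶠ ε : ℝ in 𝓝[≠] 0,
      IsActiveScalarSolution α s T K (fun t x => ε * f t x) (θ ε)) :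
    ConvergesLinearly α T (fun ε t => ε⁻¹ • θ ε t) w := by
  have hα0 : 0 < α := by linarith
  obtain ⟨B, hB, hBK⟩ := exists_sobolevSq_transportCoeff_le hα hα' hs hK
  set P := ENNReal.ofReal (1 + T) with hP
  have hPfin : P ≠ ⊤ := ENNReal.ofReal_ne_top
  set A := energy (s - α) (fun t => torusCoeff (f t)) T with hA
  have hAfin : A ≠ ⊤ := (hf.energy_lt_top (s - α) T).ne
  -- The added `1` keeps `δ = ε² D` positive even for a zero source.
  set D : ℝ := 2 * (A.toReal + 1) with hD
  have hDpos : 0 < D := by have : 0 ≤ A.toReal := ENNReal.toReal_nonneg; positivity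
  have hevsmall : ∀ᶠ ε : ℝ in 𝓝[≠] 0, 4 * (2 * (B * P ^ 3)).toReal * (ε ^ 2 * D) < 1 := by
    have hc : Continuous fun ε : ℝ => 4 * (2 * (B * P ^ 3)).toReal * (ε ^ 2 * D) := by fun_prop
    refine (hc.tendsto 0).mono_left nhdsWithin_le_nhds |>.eventually_lt_const ?_
    simp
  -- `P` serves the bound in `L^∞` and `P ^ 2` the one in `L²`, so the sum covers both.
  refine ⟨(P + P ^ 2) * (B * P ^ 3 * ENNReal.ofReal (2 * D) ^ 2), by finiteness, ?_⟩
  filter_upwards [hθ, hevsmall, self_mem_nhdsWithin] with ε hsol hsmall hε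
  have hε0 : ε ≠ 0 := hε
  have hεe : ‖ε‖ₑ ≠ 0 := enorm_ne_zero.mpr hε0
  have hg : SmoothPath fun t x => ε * f t x := contDiff_const.mul hf
  obtain ⟨hNm, hNe, hdu⟩ := hsol.fourier hα' hs hK hB hBK hg
  have hmeas := fun k => aemeasurable_torusCoeff hsol.memL2.1 k
  have hgc : ∀ t k, torusCoeff (fun x => ε * f t x) k = ε * torusCoeff (f t) k := fun t k =>
    torusCoeff_const_mul ε (f t) k
  have hgδ : 2 * energy (s - α) (fun t => torusCoeff fun x => ε * f t x) T ≤
      ENNReal.ofReal (ε ^ 2 * D) := by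
    have : (fun t => torusCoeff fun x => ε * f t x) = fun t k => (ε : ℂ) * torusCoeff (f t) k :=
      funext fun t => funext fun k => hgc t k
    rw [this, energy_const_mul _ _ fun t => torusCoeff (f t), ENNReal.ofReal_mul (sq_nonneg ε),
      ← sq_abs, ENNReal.ofReal_pow (abs_nonneg ε), ← Real.norm_eq_abs, ofReal_norm,
      ← ofReal_norm (ε : ℂ), Complex.norm_real, ofReal_norm]
    calc 2 * (‖ε‖ₑ ^ 2 * A) = ‖ε‖ₑ ^ 2 * (2 * A) := by ring
      _ ≤ ‖ε‖ₑ ^ 2 * ENNReal.ofReal D := by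
          gcongr
          rw [hD, ENNReal.ofReal_mul (by norm_num), ENNReal.ofReal_add ENNReal.toReal_nonneg
            (by norm_num), ENNReal.ofReal_toReal hAfin, ENNReal.ofReal_ofNat]
          gcongr
          exact le_self_add
  have hforce := energy_forcing_le hα0 hT hB hBK (fun k => hg.aemeasurable_torusCoeff T k) hNm hNe
    hmeas hdu (by positivity) hgδ hsmall
  set a : ℝ → Freq → ℂ := fun t => torusCoeff (θ ε t) with ha
  have hFm : ∀ k, AEMeasurable (fun t => torusCoeff (fun x => ε * f t x) k +
      -transportCoeff K (a t) k) (volume.restrict (Ioo 0 T)) := fun k =>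
    (hg.aemeasurable_torusCoeff T k).add (hNm k).neg
  -- A forcing energy of size `ε²`, squared, gives `ε⁴`; dividing the transport term by `ε` then
  -- leaves `ε²`.
  have hNle : energy (s - α) (fun t => transportCoeff K (a t)) T ≤
      B * P ^ 3 * ENNReal.ofReal (2 * D) ^ 2 * ‖ε‖ₑ ^ 4 := by
    refine (energy_transportCoeff_le hα0 hT.le hB hBK hFm
      (hforce.trans_lt ENNReal.ofReal_lt_top) hmeas hdu le_rfl).trans ?_
    calc _ ≤ B * P ^ 3 * ENNReal.ofReal (2 * (ε ^ 2 * D)) ^ 2 := by gcongr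
      _ = _ := by
        rw [show 2 * (ε ^ 2 * D) = ‖ε‖ ^ 2 * (2 * D) by rw [Real.norm_eq_abs, sq_abs]; ring,
          ENNReal.ofReal_mul (sq_nonneg _), ENNReal.ofReal_pow (norm_nonneg _), ofReal_norm]
        ring
  have hRle : energy (s - α) (fun t k => -(ε : ℂ)⁻¹ * transportCoeff K (a t) k) T ≤
      B * P ^ 3 * ENNReal.ofReal (2 * D) ^ 2 * ‖ε‖ₑ ^ 2 := by
    rw [energy_const_mul _ _ fun t => transportCoeff K (a t), enorm_neg, enorm_inv (by simpa),
      ← ofReal_norm (ε : ℂ), Complex.norm_real, ofReal_norm]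
    calc _ ≤ ‖ε‖ₑ⁻¹ ^ 2 * (B * P ^ 3 * ENNReal.ofReal (2 * D) ^ 2 * ‖ε‖ₑ ^ 4) := by gcongr
      _ = (‖ε‖ₑ⁻¹ * ‖ε‖ₑ) ^ 2 * (B * P ^ 3 * ENNReal.ofReal (2 * D) ^ 2 * ‖ε‖ₑ ^ 2) := by ring
      _ = _ := by rw [ENNReal.inv_mul_cancel hεe enorm_ne_top, one_pow, one_mul]
  have hRm : ∀ k, AEMeasurable (fun t => -(ε : ℂ)⁻¹ * transportCoeff K (a t) k)
      (volume.restrict (Ioo 0 T)) := fun k => (hNm k).const_mul _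
  have hcoef : ∀ t k, torusCoeff (ε⁻¹ • θ ε t - w t : L2Torus) k =
      (ε : ℂ)⁻¹ * a t k - torusCoeff (w t) k := fun t k => by
    rw [torusCoeff_L2_sub, torusCoeff_L2_smul, Complex.ofReal_inv]
  have hdm : ∀ k, AEMeasurable (fun t => torusCoeff (ε⁻¹ • θ ε t - w t : L2Torus) k)
      (volume.restrict (Ioo 0 T)) := fun k => by
    simp only [hcoef]
    exact ((hmeas k).const_mul _).sub (hwm k)
  -- The sources cancel: `θ/ε - w` is driven by `-ε⁻¹ ℛθ·∇θ` alone.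
  have hd : ∀ᵐ t ∂volume.restrict (Ioo 0 T), ∀ k,
      torusCoeff (ε⁻¹ • θ ε t - w t : L2Torus) k = duhamel (heatRate α k)
        (fun τ => -(ε : ℂ)⁻¹ * transportCoeff K (a τ) k) t := by
    filter_upwards [hdu, hw, ae_restrict_mem measurableSet_Ioo] with t h1 h2 ht k
    have hεc : (ε : ℂ) ≠ 0 := by exact_mod_cast hε0
    have hfi := hf.integrableOn_torusCoeff T k
    have hNi : IntegrableOn (fun τ => transportCoeff K (a τ) k) (Ioo 0 T) :=
      integrableOn_of_energy_lt_top (hNm k) hNe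
    have hadd : a t k = ε * duhamel (heatRate α k) (fun τ => torusCoeff (f τ) k) t +
        -1 * duhamel (heatRate α k) (fun τ => transportCoeff K (a τ) k) t := by
      rw [← duhamel_const_mul, ← duhamel_const_mul,
        ← duhamel_add _ ht.2.le (hfi.const_mul (ε : ℂ)) (hNi.const_mul (-1))]
      simp only [← hgc, neg_one_mul]
      exact h1 k
    rw [hcoef, h2 k, hadd, duhamel_const_mul]
    field_simp
    ring
  refine ⟨hdm, ?_, ?_⟩
  · calc energy (2 * α) (fun t => torusCoeff (ε⁻¹ • θ ε t - w t : L2Torus)) T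
        ≤ energy (s + α) (fun t => torusCoeff (ε⁻¹ • θ ε t - w t : L2Torus)) T :=
          -- The convergence holds in the stronger norms of orders `s + α` and `s`, and `s > 2 - α >
          -- 1 > α`.
          energy_mono _ (by linarith) T
      _ ≤ P ^ 2 * energy (s - α) (fun t k => -(ε : ℂ)⁻¹ * transportCoeff K (a t) k) T :=
          energy_le_energy hα0 hT.le le_rfl hRm hdm hd
      _ ≤ P ^ 2 * (B * P ^ 3 * ENNReal.ofReal (2 * D) ^ 2 * ‖ε‖ₑ ^ 2) := by gcongr
      _ ≤ (P + P ^ 2) * (B * P ^ 3 * ENNReal.ofReal (2 * D) ^ 2 * ‖ε‖ₑ ^ 2) := by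
          gcongr
          exact le_add_self
      _ = _ := by ring
  · filter_upwards [hd, ae_restrict_mem measurableSet_Ioo] with t h1 ht
    calc sobolevSq α (torusCoeff (ε⁻¹ • θ ε t - w t : L2Torus))
        ≤ sobolevSq s (torusCoeff (ε⁻¹ • θ ε t - w t : L2Torus)) :=
          sobolevSq_mono (by linarith) _
      _ ≤ P * energy (s - α) (fun t k => -(ε : ℂ)⁻¹ * transportCoeff K (a t) k) T :=
          sobolevSq_le_energy hα0 hT.le ht.2.le le_rfl hRm h1
      _ ≤ P * (B * P ^ 3 * ENNReal.ofReal (2 * D) ^ 2 * ‖ε‖ₑ ^ 2) := by gcongr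
      _ ≤ (P + P ^ 2) * (B * P ^ 3 * ENNReal.ofReal (2 * D) ^ 2 * ‖ε‖ₑ ^ 2) := by
          gcongr
          exact le_self_add
      _ = _ := by ring

end ActiveScalar

end

/-! ### The two limits. -/

theorem proposition4p2 (α s T : ℝ) (hα : 1 / 2 < α) (hα' : α < 1) (hs : 2 < s + α) (hT : 0 < T)
    (K : Torus → ℝ) (hK : IsAdmissibleKernel K)
    (f : Fin 2 → ℝ → Torus → ℝ) (hf : ∀ j, IsTestFunction (Ioo 0 T) (f j))
    (w : Fin 2 → ℝ → L2Torus) (hw : ∀ j, IsLinearSolution α T (f j) (w j))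
    (θ : Fin 2 → ℝ → ℝ → L2Torus)
    (hθ : ∀ j, ∀ᶠ ε : ℝ in 𝓝[≠] 0,
      IsActiveScalarSolution α s T K (fun t x => ε * f j t x) (θ j ε))
    (Θ : ℝ → ℝ → L2Torus)
    (hΘ : ∀ᶠ ε : ℝ in 𝓝[≠] 0,
      IsActiveScalarSolution α s T K (fun t x => ε * (f 0 t x + f 1 t x)) (Θ ε)) :
    ∀ j : Fin 2,
      ConvergesTo α T (fun ε t => ε⁻¹ • θ j ε t) (w j) ∧
      ConvergesTo α T (fun ε t => ε⁻¹ • (Θ ε t - θ j ε t)) (w (1 - j)) := by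
  have hsm : ∀ j, SmoothPath (f j) := fun j => (hf j).1
  have hwm : ∀ j k, AEMeasurable (fun t => torusCoeff (w j t) k) (volume.restrict (Ioo 0 T)) :=
    fun j k => aemeasurable_torusCoeff (hw j).memL2.1 k
  have hwd := fun j => (hw j).torusCoeff_eq_duhamel (hsm j)
  have h1 : ∀ j, ConvergesLinearly α T (fun ε t => ε⁻¹ • θ j ε t) (w j) := fun j =>
    convergesLinearly_of_solutions hα hα' hs hT hK (hsm j) (hwm j) (hwd j) (hθ j)
  have hsum : SmoothPath fun t x => f 0 t x + f 1 t x := ContDiff.add (hsm 0) (hsm 1)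
  have h2 : ConvergesLinearly α T (fun ε t => ε⁻¹ • Θ ε t) (fun t => w 0 t + w 1 t) := by
    -- The linearisation asks only for the Duhamel coefficients of its limit, so it applies to `w 0
    -- + w 1` by additivity of Duhamel's formula.
    refine convergesLinearly_of_solutions hα hα' hs hT hK hsum (fun k => ?_) ?_ hΘ
    · simp only [torusCoeff_L2_add]
      exact (hwm 0 k).add (hwm 1 k)
    · filter_upwards [hwd 0, hwd 1, ae_restrict_mem measurableSet_Ioo] with t h0 h1 ht k
      rw [torusCoeff_L2_add, h0 k, h1 k, ← duhamel_add _ ht.2.le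
        ((hsm 0).integrableOn_torusCoeff T k) ((hsm 1).integrableOn_torusCoeff T k)]
      congr 1
      ext τ
      rw [← sub_neg_eq_add, ← neg_one_mul (torusCoeff (f 1 τ) k)]
      have e1 := torusCoeff_const_mul (-1) (f 1 τ) k
      have e2 := torusCoeff_sub ((hsm 0).integrable τ) (((hsm 1).integrable τ).const_mul (-1)) k
      rw [e1] at e2
      simpa using e2.symm
  intro j
  refine ⟨(h1 j).convergesTo, ?_⟩
  -- The difference quotient is the linearisation for the summed source minus that for `f j`; its
  -- limit `w 0 + w 1 - w j` is the other solution, `1 - j` being the other index in `Fin 2`.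
  have h3 := (h2.sub (h1 j)).convergesTo
  have e0 : ∀ t, w 0 t + w 1 t - w j t = w (1 - j) t := fun t => by
    fin_cases j <;> simp
  simpa only [e0, ← smul_sub] using h3
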